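/- Let $q\in\mathbb C\setminus\{0\}$ with $q^n\neq 1$ for all $n\ge 1$. Let $\mathcal A=\mathcal O(\mathrm{SL}_q(2))$ be the Hopf algebra over $\mathbb C$ with generators $u^i_j$ ($i,j=1,2$), relations $u^1_1u^1_2=q\,u^1_2u^1_1$, $u^1_1u^2_1=q\,u^2_1u^1_1$, $u^1_2u^2_2=q\,u^2_2u^1_2$, $u^2_1u^2_2=q\,u^2_2u^2_1$, $u^1_2u^2_1=u^2_1u^1_2$, $u^1_1u^2_2-u^2_2u^1_1=(q-q^{-1})u^1_2u^2_1$, $u^1_1u^2_2-q\,u^1_2u^2_1=1$, comultiplication $\Delta(u^i_j)=\sum_k u^i_k\otimes u^k_j$ and counit $\varepsilon(u^i_j)=\delta_{ij}$. Write $\mathcal A^{\mathrm{cop}}$ for $\mathcal A$ with the opposite comultiplication $a\mapsto a_{(2)}\otimes a_{(1)}$. **Quantum sphere.** Let $$\pi=(\pi^j_i)_{j,i=-1,0,1}=\begin{pmatrix}(u^2_2)^2&-(q^2+1)u^2_2u^2_1&-q(u^2_1)^2\\-q^{-1}u^1_2u^2_2&1+(q+q^{-1})u^1_2u^2_1&u^1_1u^2_1\\-q^{-1}(u^1_2)^2&(q+q^{-1})u^1_2u^1_1&(u^1_1)^2\end{pmatrix}$$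 (row index $j$, column index $i$). Let $\alpha_{-1},\alpha_0,\alpha_1\in\mathbb C$ with $\alpha_0\ne0$ and $\alpha_{-1}\alpha_1/\alpha_0^2=c(2):=-q^4/(q^4+1)^2$. Let $\mathcal B_c$, $c=c(2)$, be the subalgebra of $\mathcal A$ generated by $e_i=\sum_j\alpha_j\pi^j_i$, $i=-1,0,1$ (so $\varepsilon(e_i)=\alpha_i$). **Notions.** A derivation $\delta$ of an algebra $\mathcal B$ is a $\mathbb C$-linear map from $\mathcal B$ to a $\mathcal B$-bimodule with $\delta(ab)=a\,\delta b+\delta a\,b$; $\Gamma(\delta)$ is the span of all $a\,\delta b$; two derivations are identified if $\sum_i a_i\,\delta b_i$ vanishes for both or for neither, for all $a_i,b_i\in\mathcal B$. For a classical point $\varphi$ of $\mathcal B$ (an algebra homomorphism $\mathcal B\to\mathbb C$, for instance $\varepsilon|_{\mathcal B}$) the right and left dimension of $\delta$ at $\varphi$ are $\dim_{\mathbb C}\Gamma(\delta)/(\Gamma(\delta)\ker\varphi)$ and $\dim_{\mathbb C}\Gamma(\delta)/(\ker\varphi\,\Gamma(\delta))$. If $\mathcal B$ is a right (left) coideal subalgebra,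 $\delta$ is called equivariant if $a\,\delta b\mapsto a_{(1)}\,\delta b_{(1)}\otimes a_{(2)}b_{(2)}$ (respectively $a\,\delta b\mapsto a_{(1)}b_{(1)}\otimes a_{(2)}\,\delta b_{(2)}$) is a well-defined linear map on $\Gamma(\delta)$. For a left coideal subalgebra $\mathcal B$ of a Hopf algebra $\mathcal H$ put $\mathcal B^+=\mathcal B\cap\ker\varepsilon$, $b^+=b-\varepsilon(b)1$. A right ideal $\mathcal R$ of $\mathcal B^+$ with projection $p:\mathcal B^+\to\mathcal B^+/\mathcal R$ determines an equivariant derivation $\delta_{\mathcal R}$ by $a\,\delta_{\mathcal R}b=a\,b_{(1)}\otimes p(b_{(2)}^+)$; conversely $\mathcal R_\delta=\{\sum_i\varepsilon(a_i)b_i^+\mid\sum_i a_i\,\delta b_i=0\}$. **Claim.** 1. $\mathcal B_c$ is a right coideal subalgebra of $\mathcal A$, hence a left coideal subalgebra of $\mathcal A^{\mathrm{cop}}$, and there is an algebra homomorphism $\tau:\mathcal B_c\to M_2(\mathbb C)$ with, for $\kappa=\frac{q^2-1}{q^4+1}\alpha_0$, $$\tau(e_{-1})=\kappa\begin{pmatrix}0&1\\0&0\end{pmatrix},\quad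 \tau(e_0)=\kappa\begin{pmatrix}-1&0\\0&q^2\end{pmatrix},\quad \tau(e_1)=\kappa\begin{pmatrix}0&0\\q^2&0\end{pmatrix}.$$ Let $x_i=\xi_1u^1_i+\xi_2u^2_i$ ($i=1,2$) with $\xi_1,\xi_2\in\mathbb C$, $\xi_2\ne0$ and $$\text{(i)}\ \ \frac{\xi_1}{\xi_2}=\frac{(q^4+1)\alpha_1}{q^4\alpha_0}\qquad\text{or}\qquad\text{(ii)}\ \ \frac{\xi_1}{\xi_2}=\frac{(q^4+1)\alpha_1}{\alpha_0},$$ and let $\delta$ be the derivation $\delta a=\omega a-a\omega$, $\omega=\gamma^1x_1+\gamma^2x_2$, of $\mathcal B_c$ with values in the $\mathcal B_c$-bimodule that is free with basis $\gamma^1,\gamma^2$ as a right $\mathcal A$-module and has the left action $a\gamma^j=\sum_i\tau_{ij}(a)\gamma^i$. In both cases $\delta$ is equivariant, and it has right dimension $2$ and left dimension $0$ at every classical point of $\mathcal B_c$. 2. Consequently, regarded as a derivation of the left coideal subalgebra $\mathcal B_c$ of $\mathcal A^{\mathrm{cop}}$, $\delta$ is equivariant, but it is not of the form $\delta_{\mathcal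 R}$ for any right ideal $\mathcal R$ of $\mathcal B_c^+$. 3. Hence the following statement, which holds if $\mathcal H$ is faithfully flat as a right $\mathcal B$-module, fails for $\mathcal B_c\subseteq\mathcal A^{\mathrm{cop}}$, and is false for general Hopf algebras $\mathcal H$ over $\mathbb C$ with left coideal subalgebras $\mathcal B$: the maps $\mathcal R\mapsto\delta_{\mathcal R}$ and $\delta\mapsto\mathcal R_\delta$ are a one-to-one correspondence between the right ideals $\mathcal R$ of $\mathcal B^+$ such that the map $\overline\Delta:\mathcal B\to\mathcal H/(\mathcal B^+\mathcal H)\otimes\mathcal B$ induced by the comultiplication satisfies $\overline\Delta(\mathcal R)\subseteq\mathcal H/(\mathcal B^+\mathcal H)\otimes\mathcal R$, and the equivariant derivations of $\mathcal B$. -/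

import Mathlib

set_option linter.unusedSimpArgs false
open scoped TensorProduct

/-- The defining relations of `O(SL_q(2))`; the generator `(i, j)` stands for `u^{i+1}_{j+1}`. -/
inductive SLqRel (q : ℂ) : FreeAlgebra ℂ (Fin 2 × Fin 2) → FreeAlgebra ℂ (Fin 2 × Fin 2) → Prop
  | ab : SLqRel q (FreeAlgebra.ι ℂ (0, 0) * FreeAlgebra.ι ℂ (0, 1))
      (q • (FreeAlgebra.ι ℂ (0, 1) * FreeAlgebra.ι ℂ (0, 0)))
  | ac : SLqRel q (FreeAlgebra.ι ℂ (0, 0) * FreeAlgebra.ι ℂ (1, 0))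
      (q • (FreeAlgebra.ι ℂ (1, 0) * FreeAlgebra.ι ℂ (0, 0)))
  | bd : SLqRel q (FreeAlgebra.ι ℂ (0, 1) * FreeAlgebra.ι ℂ (1, 1))
      (q • (FreeAlgebra.ι ℂ (1, 1) * FreeAlgebra.ι ℂ (0, 1)))
  | cd : SLqRel q (FreeAlgebra.ι ℂ (1, 0) * FreeAlgebra.ι ℂ (1, 1))
      (q • (FreeAlgebra.ι ℂ (1, 1) * FreeAlgebra.ι ℂ (1, 0)))
  | bc : SLqRel q (FreeAlgebra.ι ℂ (0, 1) * FreeAlgebra.ι ℂ (1, 0))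
      (FreeAlgebra.ι ℂ (1, 0) * FreeAlgebra.ι ℂ (0, 1))
  | ad : SLqRel q (FreeAlgebra.ι ℂ (0, 0) * FreeAlgebra.ι ℂ (1, 1)
        - FreeAlgebra.ι ℂ (1, 1) * FreeAlgebra.ι ℂ (0, 0))
      ((q - q⁻¹) • (FreeAlgebra.ι ℂ (0, 1) * FreeAlgebra.ι ℂ (1, 0)))
  | det : SLqRel q (FreeAlgebra.ι ℂ (0, 0) * FreeAlgebra.ι ℂ (1, 1)
        - q • (FreeAlgebra.ι ℂ (0, 1) * FreeAlgebra.ι ℂ (1, 0))) 1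

/-- The algebra `O(SL_q(2))`. -/
def OSLq (q : ℂ) : Type := RingQuot (SLqRel q)

namespace OSLq

noncomputable instance (q : ℂ) : Ring (OSLq q) := inferInstanceAs (Ring (RingQuot (SLqRel q)))
noncomputable instance (q : ℂ) : Algebra ℂ (OSLq q) :=
  inferInstanceAs (Algebra ℂ (RingQuot (SLqRel q)))

/-- The matrix entries `u^{i+1}_{j+1}`. -/
noncomputable def u (q : ℂ) (i j : Fin 2) : OSLq q :=
  RingQuot.mkAlgHom ℂ (SLqRel q) (FreeAlgebra.ι ℂ (i, j))

/-- The entries of the `2 × 2` matrix `v` over `X` satisfy the relations of `O(SL_q(2))`. -/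
structure Rels (q : ℂ) {X : Type*} [Ring X] [Algebra ℂ X] (v : Fin 2 → Fin 2 → X) : Prop where
  ab : v 0 0 * v 0 1 = q • (v 0 1 * v 0 0)
  ac : v 0 0 * v 1 0 = q • (v 1 0 * v 0 0)
  bd : v 0 1 * v 1 1 = q • (v 1 1 * v 0 1)
  cd : v 1 0 * v 1 1 = q • (v 1 1 * v 1 0)
  bc : v 0 1 * v 1 0 = v 1 0 * v 0 1
  ad : v 0 0 * v 1 1 - v 1 1 * v 0 0 = (q - q⁻¹) • (v 0 1 * v 1 0)
  det : v 0 0 * v 1 1 - q • (v 0 1 * v 1 0) = 1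

theorem rels_u (q : ℂ) : Rels q (u q) := by
  have h := fun {x y} (w : SLqRel q x y) => RingQuot.mkAlgHom_rel ℂ w
  refine ⟨?_, ?_, ?_, ?_, ?_, ?_, ?_⟩
  · simpa [u] using! h .ab
  · simpa [u] using! h .ac
  · simpa [u] using! h .bd
  · simpa [u] using! h .cd
  · simpa [u] using! h .bc
  · simpa [u] using! h .ad
  · simpa [u] using! h .det

/-- The universal property of `O(SL_q(2))`. -/
noncomputable def lift (q : ℂ) {X : Type*} [Ring X] [Algebra ℂ X] (v : Fin 2 → Fin 2 → X)
    (h : Rels q v) : OSLq q →ₐ[ℂ] X :=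
  RingQuot.liftAlgHom ℂ ⟨FreeAlgebra.lift ℂ fun p => v p.1 p.2, by
    intro x y w
    cases w
    · simpa using h.ab
    · simpa using h.ac
    · simpa using h.bd
    · simpa using h.cd
    · simpa using h.bc
    · simpa using h.ad
    · simpa using h.det⟩

@[simp] theorem lift_u (q : ℂ) {X : Type*} [Ring X] [Algebra ℂ X] (v : Fin 2 → Fin 2 → X)
    (h : Rels q v) (i j : Fin 2) : lift q v h (u q i j) = v i j := by
  have := RingQuot.liftAlgHom_mkAlgHom_apply (S := ℂ) (s := SLqRel q)
    (FreeAlgebra.lift ℂ fun p => v p.1 p.2) (by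
    intro x y w
    cases w
    · simpa using h.ab
    · simpa using h.ac
    · simpa using h.bd
    · simpa using h.cd
    · simpa using h.bc
    · simpa using h.ad
    · simpa using h.det) (FreeAlgebra.ι ℂ (i, j))
  exact this.trans (by simp)

theorem algHom_ext {q : ℂ} {X : Type*} [Ring X] [Algebra ℂ X] {f g : OSLq q →ₐ[ℂ] X}
    (h : ∀ i j, f (u q i j) = g (u q i j)) : f = g := by
  refine RingQuot.ringQuot_ext' ℂ f g (FreeAlgebra.hom_ext (funext fun p => ?_))
  exact h p.1 p.2

@[elab_as_elim] theorem induct {q : ℂ} {P : OSLq q → Prop} (h0 : ∀ r : ℂ, P (algebraMap ℂ _ r))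
    (hu : ∀ i j, P (u q i j)) (hadd : ∀ x y, P x → P y → P (x + y))
    (hmul : ∀ x y, P x → P y → P (x * y)) (x : OSLq q) : P x := by
  obtain ⟨y, rfl⟩ := RingQuot.mkAlgHom_surjective ℂ (SLqRel q) x
  induction y using FreeAlgebra.induction with
  | grade0 r => simpa using! h0 r
  | grade1 p => exact hu p.1 p.2
  | mul a b ha hb => simpa using! hmul _ _ ha hb
  | add a b ha hb => simpa using! hadd _ _ ha hb

section
variable {q : ℂ} {X : Type*} [Ring X] [Algebra ℂ X] {v : Fin 2 → Fin 2 → X}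
theorem Rels.da (h : Rels q v) : v 1 1 * v 0 0 = 1 + q⁻¹ • (v 1 0 * v 0 1) := by
  have h1 := h.ad
  have h2 := h.det
  rw [h.bc] at h1 h2
  rw [eq_add_of_sub_eq h2, sub_smul] at h1
  rw [← sub_eq_zero] at h1 ⊢
  rw [← neg_eq_zero, ← h1]
  abel
theorem Rels.ad' (h : Rels q v) : v 0 0 * v 1 1 = 1 + q • (v 1 0 * v 0 1) := by
  rw [← h.bc]; exact eq_add_of_sub_eq h.det
end

/-- `Δ(u^i_j) = ∑ₖ u^i_k ⊗ u^k_j`. -/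
noncomputable def comulGen (q : ℂ) (i j : Fin 2) : OSLq q ⊗[ℂ] OSLq q :=
  ∑ k, u q i k ⊗ₜ[ℂ] u q k j

theorem rels_comul (q : ℂ) [NeZero q] : Rels q (comulGen q) := by
  have hq : q ≠ 0 := NeZero.ne q
  have h := rels_u q
  constructor <;>
  · simp only [comulGen, Fin.sum_univ_two, add_mul, mul_add,
      Algebra.TensorProduct.tmul_mul_tmul, h.ab, h.ac, h.bd, h.cd, h.bc, h.da, h.ad',
      TensorProduct.tmul_add, TensorProduct.add_tmul, TensorProduct.tmul_smul,
      ← TensorProduct.smul_tmul', smul_add, smul_smul, Algebra.TensorProduct.one_def]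
    match_scalars <;> field_simp <;> ring

theorem rels_counit (q : ℂ) : Rels q (fun i j : Fin 2 => if i = j then (1 : ℂ) else 0) := by
  constructor <;> simp

noncomputable instance instBialgebra (q : ℂ) [NeZero q] : Bialgebra ℂ (OSLq q) :=
  Bialgebra.ofAlgHom (lift q (comulGen q) (rels_comul q)) (lift q _ (rels_counit q))
    (algHom_ext fun i j => by
      simp [comulGen, TensorProduct.add_tmul, TensorProduct.tmul_add]
      abel)
    (algHom_ext fun i j => by
      fin_cases i <;> fin_cases j <;> simp [comulGen])
    (algHom_ext fun i j => by
      fin_cases i <;> fin_cases j <;> simp [comulGen])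

theorem comul_u (q : ℂ) [NeZero q] (i j : Fin 2) :
    Coalgebra.comul (R := ℂ) (u q i j) = ∑ k, u q i k ⊗ₜ[ℂ] u q k j :=
  lift_u q _ (rels_comul q) i j

theorem counit_u (q : ℂ) [NeZero q] (i j : Fin 2) :
    Coalgebra.counit (R := ℂ) (u q i j) = if i = j then (1 : ℂ) else 0 :=
  lift_u q _ (rels_counit q) i j

/-- The values of the antipode on the `u^i_j`. -/
noncomputable def antipodeGen (q : ℂ) : Fin 2 → Fin 2 → (OSLq q)ᵐᵒᵖ :=
  !![MulOpposite.op (u q 1 1), MulOpposite.op (-q⁻¹ • u q 0 1);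
    MulOpposite.op (-q • u q 1 0), MulOpposite.op (u q 0 0)]

theorem rels_antipode (q : ℂ) [NeZero q] : Rels q (antipodeGen q) := by
  have hq : q ≠ 0 := NeZero.ne q
  have h := rels_u q
  constructor <;> apply MulOpposite.unop_injective <;>
  · simp [antipodeGen, h.ab, h.ac, h.bd, h.cd, h.bc, h.da, h.ad', smul_smul]
    try (match_scalars <;> field_simp <;> ring)

/-- The antipode of `O(SL_q(2))`. -/
noncomputable def antipode (q : ℂ) [NeZero q] : OSLq q →ₗ[ℂ] OSLq q :=
  (MulOpposite.opLinearEquiv ℂ).symm.toLinearMap ∘ₗ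
    (lift q (antipodeGen q) (rels_antipode q)).toLinearMap

theorem antipode_mul (q : ℂ) [NeZero q] (x y : OSLq q) :
    antipode q (x * y) = antipode q y * antipode q x := by
  simp [antipode]

theorem antipode_u (q : ℂ) [NeZero q] (i j : Fin 2) :
    antipode q (u q i j) = (antipodeGen q i j).unop := by
  simp [antipode]

theorem antipode_algebraMap (q : ℂ) [NeZero q] (r : ℂ) :
    antipode q (algebraMap ℂ _ r) = algebraMap ℂ _ r := by
  simp [antipode]

theorem antipode_one (q : ℂ) [NeZero q] : antipode q 1 = 1 := by
  simp [antipode]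

/-- `O(SL_q(2))` is a Hopf algebra. -/
noncomputable instance instHopfAlgebra (q : ℂ) [NeZero q] : HopfAlgebra ℂ (OSLq q) where
  antipode := antipode q
  mul_antipode_rTensor_comul := by
    have hq : q ≠ 0 := NeZero.ne q
    have h := rels_u q
    refine LinearMap.ext fun x => ?_
    simp only [LinearMap.comp_apply, Algebra.linearMap_apply]
    induction x using induct with
    | h0 r => simp [Algebra.TensorProduct.algebraMap_apply, antipode_algebraMap, antipode_one]
    | hu i j =>
      fin_cases i <;> fin_cases j <;>
      · simp [comul_u, counit_u, antipode_u, antipodeGen, h.ab, h.ac, h.bd, h.cd, h.bc, h.da, h.ad', smul_smul, hq]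
    | hadd x y hx hy => simp [hx, hy]
    | hmul x y hx hy =>
      rw [Bialgebra.comul_mul, Bialgebra.counit_mul, map_mul (algebraMap ℂ (OSLq q)), ← hy]
      have key : ∀ s t : OSLq q ⊗[ℂ] OSLq q,
          LinearMap.mul' ℂ (OSLq q) ((antipode q).rTensor _ s) = algebraMap ℂ _ (Coalgebra.counit x) →
          LinearMap.mul' ℂ (OSLq q) ((antipode q).rTensor _ (s * t)) =
          algebraMap ℂ _ (Coalgebra.counit x) * LinearMap.mul' ℂ (OSLq q) ((antipode q).rTensor _ t) := by
        intro s t hs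
        induction t using TensorProduct.induction_on with
        | zero => simp
        | add t t' ht ht' => simp [mul_add, ht, ht']
        | tmul a b =>
          have : ∀ s : OSLq q ⊗[ℂ] OSLq q,
              LinearMap.mul' ℂ (OSLq q) ((antipode q).rTensor _ (s * (a ⊗ₜ b))) =
              antipode q a * LinearMap.mul' ℂ (OSLq q) ((antipode q).rTensor _ s) * b := by
            intro s
            induction s using TensorProduct.induction_on with
            | zero => simp
            | add t t' ht ht' => simp [add_mul, mul_add, ht, ht']
            | tmul c d => simp [antipode_mul, mul_assoc]
          rw [this, hs, ← Algebra.commutes, mul_assoc]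
          simp
      exact key _ _ hx
  mul_antipode_lTensor_comul := by
    have hq : q ≠ 0 := NeZero.ne q
    have h := rels_u q
    refine LinearMap.ext fun x => ?_
    simp only [LinearMap.comp_apply, Algebra.linearMap_apply]
    induction x using induct with
    | h0 r => simp [Algebra.TensorProduct.algebraMap_apply, antipode_algebraMap, antipode_one]
    | hu i j =>
      fin_cases i <;> fin_cases j <;>
      · simp [comul_u, counit_u, antipode_u, antipodeGen, h.ab, h.ac, h.bd, h.cd, h.bc, h.da, h.ad', smul_smul, hq]
    | hadd x y hx hy => simp [hx, hy]
    | hmul x y hx hy =>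
      rw [Bialgebra.comul_mul, Bialgebra.counit_mul, map_mul (algebraMap ℂ (OSLq q)), ← hx]
      have key : ∀ s t : OSLq q ⊗[ℂ] OSLq q,
          LinearMap.mul' ℂ (OSLq q) ((antipode q).lTensor _ t) = algebraMap ℂ _ (Coalgebra.counit y) →
          LinearMap.mul' ℂ (OSLq q) ((antipode q).lTensor _ (s * t)) =
          LinearMap.mul' ℂ (OSLq q) ((antipode q).lTensor _ s) * algebraMap ℂ _ (Coalgebra.counit y) := by
        intro s t ht
        induction s using TensorProduct.induction_on with
        | zero => simp
        | add t t' ht ht' => simp [add_mul, ht, ht']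
        | tmul a b =>
          have : ∀ t : OSLq q ⊗[ℂ] OSLq q,
              LinearMap.mul' ℂ (OSLq q) ((antipode q).lTensor _ ((a ⊗ₜ b) * t)) =
              a * LinearMap.mul' ℂ (OSLq q) ((antipode q).lTensor _ t) * antipode q b := by
            intro s
            induction s using TensorProduct.induction_on with
            | zero => simp
            | add t t' ht ht' => simp [add_mul, mul_add, ht, ht']
            | tmul c d => simp [antipode_mul, mul_assoc]
          rw [this, ht, mul_assoc, Algebra.commutes, ← mul_assoc]
          simp
      exact key _ _ hy
end OSLq

namespace Covariant

/-! First order differential calculi on coideal subalgebras. -/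

section General

variable {A : Type} [Ring A] [Algebra ℂ A]

/-- `Δ(B) ⊆ A ⊗ B`. -/
def IsLeftCoideal (Δ : A →ₗ[ℂ] A ⊗[ℂ] A) (B : Subalgebra ℂ A) : Prop :=
  ∀ b : B, Δ b ∈ LinearMap.range (LinearMap.lTensor A B.val.toLinearMap)

/-- `Δ(B) ⊆ B ⊗ A`. -/
def IsRightCoideal (Δ : A →ₗ[ℂ] A ⊗[ℂ] A) (B : Subalgebra ℂ A) : Prop :=
  ∀ b : B, Δ b ∈ LinearMap.range (LinearMap.rTensor A B.val.toLinearMap)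

theorem lTensor_val_injective (B : Subalgebra ℂ A) :
    Function.Injective (LinearMap.lTensor A B.val.toLinearMap) :=
  Module.Flat.lTensor_preserves_injective_linearMap _ Subtype.val_injective

theorem rTensor_val_injective (B : Subalgebra ℂ A) :
    Function.Injective (LinearMap.rTensor A B.val.toLinearMap) :=
  Module.Flat.rTensor_preserves_injective_linearMap _ Subtype.val_injective

/-- `Δ`, restricted to a map `B → A ⊗ B`. -/
noncomputable def leftCoact {Δ : A →ₗ[ℂ] A ⊗[ℂ] A} {B : Subalgebra ℂ A}
    (hB : IsLeftCoideal Δ B) : B →ₗ[ℂ] A ⊗[ℂ] B :=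
  (LinearEquiv.ofInjective _ (lTensor_val_injective B)).symm.toLinearMap ∘ₗ
    LinearMap.codRestrict _ (Δ ∘ₗ B.val.toLinearMap) hB

/-- `Δ`, restricted to a map `B → B ⊗ A`. -/
noncomputable def rightCoact {Δ : A →ₗ[ℂ] A ⊗[ℂ] A} {B : Subalgebra ℂ A}
    (hB : IsRightCoideal Δ B) : B →ₗ[ℂ] B ⊗[ℂ] A :=
  (LinearEquiv.ofInjective _ (rTensor_val_injective B)).symm.toLinearMap ∘ₗ
    LinearMap.codRestrict _ (Δ ∘ₗ B.val.toLinearMap) hB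

theorem lTensor_leftCoact {Δ : A →ₗ[ℂ] A ⊗[ℂ] A} {B : Subalgebra ℂ A}
    (hB : IsLeftCoideal Δ B) (b : B) :
    LinearMap.lTensor A B.val.toLinearMap (leftCoact hB b) = Δ b :=
  congrArg Subtype.val ((LinearEquiv.ofInjective _ (lTensor_val_injective B)).apply_symm_apply
    (LinearMap.codRestrict _ (Δ ∘ₗ B.val.toLinearMap) hB b))

theorem rTensor_rightCoact {Δ : A →ₗ[ℂ] A ⊗[ℂ] A} {B : Subalgebra ℂ A}
    (hB : IsRightCoideal Δ B) (b : B) :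
    LinearMap.rTensor A B.val.toLinearMap (rightCoact hB b) = Δ b :=
  congrArg Subtype.val ((LinearEquiv.ofInjective _ (rTensor_val_injective B)).apply_symm_apply
    (LinearMap.codRestrict _ (Δ ∘ₗ B.val.toLinearMap) hB b))

/-- A derivation `d` of a `ℂ`-algebra `B` with values in some `B`-bimodule `M`. -/
structure BimoduleDerivation (B : Type) [Ring B] [Algebra ℂ B] where
  M : Type
  [addCommGroup : AddCommGroup M]
  [module : Module ℂ M]
  [leftModule : Module B M]
  [rightModule : Module Bᵐᵒᵖ M]
  [leftTower : IsScalarTower ℂ B M]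
  [rightTower : IsScalarTower ℂ Bᵐᵒᵖ M]
  [smulComm : SMulCommClass B Bᵐᵒᵖ M]
  d : B →ₗ[ℂ] M
  leibniz : ∀ a b : B, d (a * b) = a • d b + MulOpposite.op b • d a

attribute [instance] BimoduleDerivation.addCommGroup BimoduleDerivation.module
  BimoduleDerivation.leftModule BimoduleDerivation.rightModule BimoduleDerivation.leftTower
  BimoduleDerivation.rightTower BimoduleDerivation.smulComm

namespace BimoduleDerivation

section
variable {B : Type} [Ring B] [Algebra ℂ B] (δ : BimoduleDerivation B)

/-- The map `B ⊗ B → M`, `a ⊗ b ↦ a (δ b)`. -/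
noncomputable def mulD : B ⊗[ℂ] B →ₗ[ℂ] δ.M :=
  TensorProduct.lift ((Algebra.lsmul ℂ ℂ δ.M).toLinearMap.compl₂ δ.d)

theorem mulD_tmul (a b : B) : δ.mulD (a ⊗ₜ b) = a • δ.d b := by
  simp [mulD]

/-- `Γ(δ)`, the span of all `a (δ b)`. -/
noncomputable def Gam : Submodule ℂ δ.M := LinearMap.range δ.mulD

/-- The bilinear map `B × B → Γ(δ)`, `(a, b) ↦ a (δ b)`. -/
noncomputable def mulDGam : B →ₗ[ℂ] B →ₗ[ℂ] δ.Gam :=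
  TensorProduct.curry δ.mulD.rangeRestrict

theorem coe_mulDGam (a b : B) : (δ.mulDGam a b : δ.M) = a • δ.d b := δ.mulD_tmul a b

/-- `(ker φ) Γ(δ)` as a subspace of `Γ(δ)`, for a classical point `φ`. -/
noncomputable def leftAug (φ : B →ₐ[ℂ] ℂ) : Submodule ℂ δ.Gam :=
  (Submodule.span ℂ {m : δ.M | ∃ b : B, φ b = 0 ∧ ∃ g ∈ δ.Gam, m = b • g}).comap δ.Gam.subtype

/-- `Γ(δ) (ker φ)` as a subspace of `Γ(δ)`, for a classical point `φ`. -/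
noncomputable def rightAug (φ : B →ₐ[ℂ] ℂ) : Submodule ℂ δ.Gam :=
  (Submodule.span ℂ {m : δ.M | ∃ b : B, φ b = 0 ∧ ∃ g ∈ δ.Gam,
    m = MulOpposite.op b • g}).comap δ.Gam.subtype

/-- The left dimension of `δ` at the classical point `φ`. -/
noncomputable def leftDim (φ : B →ₐ[ℂ] ℂ) : Cardinal := Module.rank ℂ (δ.Gam ⧸ δ.leftAug φ)

/-- The right dimension of `δ` at the classical point `φ`. -/
noncomputable def rightDim (φ : B →ₐ[ℂ] ℂ) : Cardinal := Module.rank ℂ (δ.Gam ⧸ δ.rightAug φ)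

end

variable {B : Subalgebra ℂ A}

/-- The map `Γ(δ) → A ⊗ Γ(δ)`, `a (δ b) ↦ a₍₁₎ b₍₁₎ ⊗ a₍₂₎ (δ b₍₂₎)`, is well defined. -/
def IsLeftEquivariant {Δ : A →ₗ[ℂ] A ⊗[ℂ] A} (hB : IsLeftCoideal Δ B)
    (δ : BimoduleDerivation B) : Prop :=
  ∃ Φ : δ.Gam →ₗ[ℂ] A ⊗[ℂ] δ.Gam, ∀ a b : B,
    Φ (δ.mulDGam a b) =
      TensorProduct.map₂ (LinearMap.mul ℂ A) δ.mulDGam (leftCoact hB a) (leftCoact hB b)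

/-- The map `Γ(δ) → Γ(δ) ⊗ A`, `a (δ b) ↦ a₍₁₎ (δ b₍₁₎) ⊗ a₍₂₎ b₍₂₎`, is well defined. -/
def IsRightEquivariant {Δ : A →ₗ[ℂ] A ⊗[ℂ] A} (hB : IsRightCoideal Δ B)
    (δ : BimoduleDerivation B) : Prop :=
  ∃ Φ : δ.Gam →ₗ[ℂ] δ.Gam ⊗[ℂ] A, ∀ a b : B,
    Φ (δ.mulDGam a b) =
      TensorProduct.map₂ δ.mulDGam (LinearMap.mul ℂ A) (rightCoact hB a) (rightCoact hB b)

end BimoduleDerivation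

/-- `B⁺`, the kernel of the counit on `B`. -/
noncomputable def augKer (ε : A →ₐ[ℂ] ℂ) (B : Subalgebra ℂ A) : Submodule ℂ B :=
  LinearMap.ker (ε.comp B.val).toLinearMap

/-- The map `B → B⁺`, `b ↦ b⁺ = b - ε(b) 1`. -/
noncomputable def plus (ε : A →ₐ[ℂ] ℂ) (B : Subalgebra ℂ A) : B →ₗ[ℂ] augKer ε B :=
  LinearMap.codRestrict _
    (LinearMap.id - (Algebra.linearMap ℂ B) ∘ₗ (ε.comp B.val).toLinearMap)
    (fun b => by
      change (ε.comp B.val) (b - algebraMap ℂ B ((ε.comp B.val) b)) = 0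
      rw [map_sub, AlgHom.commutes]
      exact sub_self _)

/-- The subspace `R` of `B⁺` satisfies `R B⁺ ⊆ R`. -/
def IsRightIdeal {ε : A →ₐ[ℂ] ℂ} {B : Subalgebra ℂ A} (R : Submodule ℂ (augKer ε B)) : Prop :=
  ∀ r ∈ R, ∀ s t : augKer ε B, (t : B) = r * s → t ∈ R

/-- With `p : B⁺ → B⁺ / R` the projection, the map `B ⊗ B → A ⊗ (B⁺ / R)`,
`a ⊗ b ↦ a b₍₁₎ ⊗ p(b₍₂₎⁺)`. -/
noncomputable def idealMap {Δ : A →ₗ[ℂ] A ⊗[ℂ] A} {B : Subalgebra ℂ A} (hB : IsLeftCoideal Δ B)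
    {ε : A →ₐ[ℂ] ℂ} (R : Submodule ℂ (augKer ε B)) :
    B ⊗[ℂ] B →ₗ[ℂ] A ⊗[ℂ] (augKer ε B ⧸ R) :=
  TensorProduct.lift
    ((LinearMap.rTensorHom (augKer ε B ⧸ R) ∘ₗ LinearMap.mul ℂ A ∘ₗ B.val.toLinearMap).compl₂
      (LinearMap.lTensor A (R.mkQ ∘ₗ plus ε B) ∘ₗ leftCoact hB))

/-- The derivation `δ` is (up to identification) the derivation `δ_R` of the right ideal `R`, that
is, `a (δ b) = a b₍₁₎ ⊗ p(b₍₂₎⁺)`: a sum `∑ aᵢ (δ bᵢ)` vanishes if and only if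
`∑ aᵢ bᵢ₍₁₎ ⊗ p(bᵢ₍₂₎⁺)` does. -/
def ArisesFrom {Δ : A →ₗ[ℂ] A ⊗[ℂ] A} {B : Subalgebra ℂ A} (hB : IsLeftCoideal Δ B)
    {ε : A →ₐ[ℂ] ℂ} (δ : BimoduleDerivation B) (R : Submodule ℂ (augKer ε B)) : Prop :=
  LinearMap.ker δ.mulD = LinearMap.ker (idealMap hB R)

/-- `R_δ`, the space of all `∑ ε(aᵢ) bᵢ⁺` with `∑ aᵢ (δ bᵢ) = 0`. -/
noncomputable def idealOf {B : Subalgebra ℂ A} (ε : A →ₐ[ℂ] ℂ) (δ : BimoduleDerivation B) :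
    Submodule ℂ (augKer ε B) :=
  (LinearMap.ker δ.mulD).map
    ((TensorProduct.lid ℂ (augKer ε B)).toLinearMap ∘ₗ
      TensorProduct.map (ε.comp B.val).toLinearMap (plus ε B))

/-- `B⁺ A`. -/
def augMul (ε : A →ₐ[ℂ] ℂ) (B : Subalgebra ℂ A) : Submodule ℂ A :=
  Submodule.span ℂ {x : A | ∃ b : augKer ε B, ∃ a : A, x = b * a}

/-- The image of `R` in `A/(B⁺ A) ⊗ B` under the map induced by `Δ` lies in `A/(B⁺ A) ⊗ R`. -/
def IsStable {Δ : A →ₗ[ℂ] A ⊗[ℂ] A} {B : Subalgebra ℂ A} (hB : IsLeftCoideal Δ B)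
    {ε : A →ₐ[ℂ] ℂ} (R : Submodule ℂ (augKer ε B)) : Prop :=
  ∀ r ∈ R, LinearMap.rTensor B (augMul ε B).mkQ (leftCoact hB r) ∈
    LinearMap.range (LinearMap.lTensor (A ⧸ augMul ε B) ((augKer ε B).subtype ∘ₗ R.subtype))

/-- The assignments `R ↦ δ_R` and `δ ↦ R_δ` are mutually inverse bijections between the right
ideals `R` of `B⁺` that are stable in the sense of `IsStable` and the (identity classes of)
equivariant derivations of `B`. -/
def OneToOneCorrespondence {Δ : A →ₗ[ℂ] A ⊗[ℂ] A} {B : Subalgebra ℂ A}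
    (hB : IsLeftCoideal Δ B) (ε : A →ₐ[ℂ] ℂ) : Prop :=
  (∀ R : Submodule ℂ (augKer ε B), IsRightIdeal R → IsStable hB R →
    ∃ δ : BimoduleDerivation B,
      δ.IsLeftEquivariant hB ∧ ArisesFrom hB δ R ∧ idealOf ε δ = R) ∧
  (∀ δ : BimoduleDerivation B, δ.IsLeftEquivariant hB →
    IsRightIdeal (idealOf ε δ) ∧ IsStable hB (idealOf ε δ) ∧ ArisesFrom hB δ (idealOf ε δ))

/-- The opposite comultiplication `a ↦ a₍₂₎ ⊗ a₍₁₎`. -/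
noncomputable def opComul (Δ : A →ₗ[ℂ] A ⊗[ℂ] A) : A →ₗ[ℂ] A ⊗[ℂ] A :=
  (TensorProduct.comm ℂ A A).toLinearMap ∘ₗ Δ

end General

section Inner

variable {A : Type} [Ring A] [Algebra ℂ A] {B : Subalgebra ℂ A}

/-- The `B`-`B`-bimodule with basis `γ¹, γ²` as a right `A`-module (so that `m : Fin 2 → A` stands
for `∑ γⁱ mᵢ`) and left multiplication `a γʲ = ∑ᵢ τᵢⱼ(a) γⁱ`. -/
def Twisted (_τ : B →ₐ[ℂ] Matrix (Fin 2) (Fin 2) ℂ) : Type := Fin 2 → A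

variable (τ : B →ₐ[ℂ] Matrix (Fin 2) (Fin 2) ℂ)

namespace Twisted

instance : AddCommGroup (Twisted τ) := inferInstanceAs (AddCommGroup (Fin 2 → A))
instance : Module ℂ (Twisted τ) := inferInstanceAs (Module ℂ (Fin 2 → A))

instance : SMul B (Twisted τ) := ⟨fun a m => (fun i => ∑ j, τ a i j • m j : Fin 2 → A)⟩
instance : SMul Bᵐᵒᵖ (Twisted τ) := ⟨fun b m => (fun i => m i * (b.unop : A) : Fin 2 → A)⟩

variable {τ}

@[ext] theorem ext {m m' : Twisted τ} (h : ∀ i, m i = m' i) : m = m' := funext h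

theorem add_apply (m m' : Twisted τ) (i : Fin 2) : (m + m') i = m i + m' i := rfl
theorem zero_apply (i : Fin 2) : (0 : Twisted τ) i = 0 := rfl
theorem csmul_apply (z : ℂ) (m : Twisted τ) (i : Fin 2) : (z • m) i = z • m i := rfl
theorem smul_apply (a : B) (m : Twisted τ) (i : Fin 2) : (a • m) i = ∑ j, τ a i j • m j := rfl
theorem op_smul_apply (b : Bᵐᵒᵖ) (m : Twisted τ) (i : Fin 2) :
    (b • m) i = m i * (b.unop : A) := rfl

instance : Module B (Twisted τ) where
  one_smul m := by ext i; fin_cases i <;> simp [smul_apply]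
  mul_smul a b m := by
    ext i
    simp [smul_apply, Matrix.mul_apply, Fin.sum_univ_two, add_smul, smul_smul]
    abel
  smul_zero a := by ext i; simp [smul_apply, zero_apply]
  smul_add a m m' := by ext i; simp [smul_apply, add_apply]; abel
  add_smul a b m := by ext i; simp [smul_apply, add_apply, add_smul]; abel
  zero_smul m := by ext i; simp [smul_apply, zero_apply]

instance : Module Bᵐᵒᵖ (Twisted τ) where
  one_smul m := by ext i; simp [op_smul_apply]
  mul_smul a b m := by ext i; simp [op_smul_apply, mul_assoc]
  smul_zero a := by ext i; simp [op_smul_apply, zero_apply]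
  smul_add a m m' := by ext i; simp [op_smul_apply, add_apply, add_mul]
  add_smul a b m := by ext i; simp [op_smul_apply, add_apply, mul_add]
  zero_smul m := by ext i; simp [op_smul_apply, zero_apply]

instance : IsScalarTower ℂ B (Twisted τ) :=
  ⟨fun z a m => by ext i; simp [smul_apply, csmul_apply, smul_smul]⟩

instance : IsScalarTower ℂ Bᵐᵒᵖ (Twisted τ) :=
  ⟨fun z a m => by ext i; simp [op_smul_apply, csmul_apply]⟩

instance : SMulCommClass B Bᵐᵒᵖ (Twisted τ) :=
  ⟨fun a b m => by ext i; simp [smul_apply, op_smul_apply, add_mul]⟩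

end Twisted

/-- The element `∑ γⁱ xᵢ`. -/
def Twisted.mk (x : Fin 2 → A) : Twisted τ := x

/-- The derivation `δ a = ω a - a ω` of `B` with `ω = ∑ γⁱ xᵢ`. -/
noncomputable def innerDerivation (x : Fin 2 → A) : BimoduleDerivation B where
  M := Twisted τ
  d :=
    { toFun := fun a => MulOpposite.op a • Twisted.mk τ x - a • Twisted.mk τ x
      map_add' := fun a b => by
        rw [MulOpposite.op_add, add_smul, add_smul]
        abel
      map_smul' := fun z a => by
        rw [MulOpposite.op_smul, smul_assoc, smul_assoc, RingHom.id_apply, smul_sub] }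
  leibniz a b := by
    change MulOpposite.op (a * b) • Twisted.mk τ x - (a * b) • Twisted.mk τ x =
      a • (MulOpposite.op b • Twisted.mk τ x - b • Twisted.mk τ x) +
      MulOpposite.op b • (MulOpposite.op a • Twisted.mk τ x - a • Twisted.mk τ x)
    rw [MulOpposite.op_mul, mul_smul, mul_smul, smul_sub, smul_sub,
      smul_comm a (MulOpposite.op b)]
    abel

end Inner

end Covariant

namespace OSLq

/-- The matrix `(π^i_j)` of the spin 1 corepresentation of `O(SL_q(2))`; the rows and columns
`0, 1, 2` belong to the indices `-1, 0, 1`. -/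
noncomputable def spinOne (q : ℂ) : Matrix (Fin 3) (Fin 3) (OSLq q) :=
  !![u q 1 1 * u q 1 1, -(q ^ 2 + 1) • (u q 1 1 * u q 1 0), -q • (u q 1 0 * u q 1 0);
    -q⁻¹ • (u q 0 1 * u q 1 1), 1 + (q + q⁻¹) • (u q 0 1 * u q 1 0), u q 0 0 * u q 1 0;
    -q⁻¹ • (u q 0 1 * u q 0 1), (q + q⁻¹) • (u q 0 1 * u q 0 0), u q 0 0 * u q 0 0]

/-- The generators `e_{-1}, e_0, e_1` (indexed by `0, 1, 2`), `e_i = ∑ⱼ αⱼ π^j_i`, of the algebra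
of functions on the quantum 2-sphere; `αᵢ = ε(eᵢ)`. -/
noncomputable def sphereGen (q : ℂ) (α : Fin 3 → ℂ) (i : Fin 3) : OSLq q :=
  ∑ j, α j • spinOne q j i

/-- The algebra `B_c` of functions on the quantum 2-sphere of Podleś inside `O(SL_q(2))`, where
`c = α₋₁ α₁ : α₀²`. -/
noncomputable def sphere (q : ℂ) (α : Fin 3 → ℂ) : Subalgebra ℂ (OSLq q) :=
  Algebra.adjoin ℂ (Set.range (sphereGen q α))

theorem sphereGen_mem (q : ℂ) (α : Fin 3 → ℂ) (i : Fin 3) : sphereGen q α i ∈ sphere q α :=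
  Algebra.subset_adjoin ⟨i, rfl⟩

/-- The special values `c(n) = -q^{2n} / (q^{2n} + 1)²` of the parameter. -/
noncomputable def specialParam (q : ℂ) (n : ℕ) : ℂ := -q ^ (2 * n) / (q ^ (2 * n) + 1) ^ 2

/-- The values on `e_{-1}, e_0, e_1` of the two-dimensional representation of `B_{c(2)}`. -/
noncomputable def tauGen (q : ℂ) (α : Fin 3 → ℂ) : Fin 3 → Matrix (Fin 2) (Fin 2) ℂ :=
  ![((q ^ 2 - 1) / (q ^ 4 + 1) * α 1) • !![0, 1; 0, 0],
    ((q ^ 2 - 1) / (q ^ 4 + 1) * α 1) • !![-1, 0; 0, q ^ 2],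
    ((q ^ 2 - 1) / (q ^ 4 + 1) * α 1) • !![0, 0; q ^ 2, 0]]

/-- The elements `xᵢ = ξ₁ u^1_i + ξ₂ u^2_i`; thus `ε(xᵢ) = ξᵢ` and `Δ(xᵢ) = ∑ⱼ xⱼ ⊗ u^j_i`. -/
noncomputable def spinor (q : ℂ) (ξ : Fin 2 → ℂ) (i : Fin 2) : OSLq q :=
  ∑ k, ξ k • u q k i

end OSLq

/-! The idea is to find an element of `B` that every classical point kills but that acts as the
identity from the left on the bimodule of `δ`. The indices 0, 1, 2 stand for -1, 0, 1.

The numbers `α` form a q-analogue of a binary quadratic form. At the parameter `c(2)` it factors as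
`r • η ξ` with linear forms whose coefficients are powers of q times one number `y`, and the two
choices of the right factor `ξ` are cases (i) and (ii). Hence the sphere is generated by the
products `ηᵢ ξⱼ` of two spinors, and everything follows from one exchange relation,
`spinor_mul_spinor`.

Representation: on Laurent polynomials with weighted shifts, the coefficient of `e₋₁` vanishes at
`z⁰` and at `z⁴`. This cuts out a two-dimensional subquotient spanned by `z²` and `z⁴`, which is `τ`
(`exists_tau`).

Equivariance: the basis `γ` is given the coaction with matrix `S⁻¹(u)`, for which `ω` is invariant.
It is compatible with the left action because `τ` intertwines (`slice_mul_skewMatrix`), so `δ a = ω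
a - a ω` is equivariant.

Dimensions: `Z = e₀ - α₀` is normal, vanishes at all classical points, and `τ Z` is invertible. With
`τ Z * τ g = 1`, the element `b = Z * g` acts as 1 from the left, so `(ker φ) Γ = Γ` and the left
dimension is 0. On the right, `Γ` contains every `γⁱ xⱼ n` with `τ n = 0`, and `x₁ B + x₂ B` is
projective with one-dimensional fibre at `φ`; thus the fibre of `Γ` is `ℂ²`
(`rightDim_innerDerivation`).

Contradiction with ideals: if `δ = δ_R`, then `(b - 1) δc = 0` for all `c`, and applying the counit
to the first tensor factor gives `p(c⁺) = 0`. So `δ_R = 0`, against right dimension 2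
(`ArisesFrom.Gam_eq_bot`). Since the opposite comultiplication also gives a Hopf algebra, with
antipode `S⁻¹`, the general statement fails as well. -/

namespace OSLq

/-! ### Splitting the generators of the sphere into products of spinors. -/

theorem spinor_mul_spinor (q : ℂ) [NeZero q] (ξ η : Fin 2 → ℂ) :
    spinor q ξ 0 * spinor q η 1 =
      q • (spinor q ξ 1 * spinor q η 0) + algebraMap ℂ _ (ξ 0 * η 1 - q * ξ 1 * η 0) := by
  have hq : q ≠ 0 := NeZero.ne q
  have h := rels_u q
  simp only [spinor, Fin.sum_univ_two, add_mul, mul_add, smul_mul_assoc, mul_smul_comm,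
    h.ab, h.ac, h.bd, h.cd, h.bc, h.da, h.ad', Algebra.algebraMap_eq_smul_one]
  match_scalars <;> field_simp; ring

theorem comul_spinor (q : ℂ) [NeZero q] (ξ : Fin 2 → ℂ) (i : Fin 2) :
    Coalgebra.comul (R := ℂ) (spinor q ξ i) = ∑ j, spinor q ξ j ⊗ₜ[ℂ] u q j i := by
  simp only [spinor, Fin.sum_univ_two, map_add, map_smul, comul_u, TensorProduct.add_tmul,
    ← TensorProduct.smul_tmul', smul_add]
  abel

/-- The quadratic form `α` splits as `r` times the product of the linear forms `η` and `ξ`. -/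
structure Splits (q : ℂ) (α : Fin 3 → ℂ) (η ξ : Fin 2 → ℂ) (r : ℂ) : Prop where
  ne_zero : r ≠ 0
  eq_two : α 2 = r * η 0 * ξ 0
  eq_one : α 1 = r * (η 0 * ξ 1 + q⁻¹ * η 1 * ξ 0)
  eq_zero : α 0 = -q⁻¹ * r * η 1 * ξ 1

namespace Splits
variable {q : ℂ} [NeZero q] {α : Fin 3 → ℂ} {η ξ : Fin 2 → ℂ} {r : ℂ}

/-- Expanding the product of spinors and reordering to `u^2_1 u^1_1` produces exactly the weights in
`Splits`: the factor `q⁻¹` in `eq_one` comes from the commutation of `u^1_1` with `u^2_1`. -/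
theorem sphereGen_two (h : Splits q α η ξ r) :
    sphereGen q α 2 = r • (spinor q η 0 * spinor q ξ 0) := by
  have hq : q ≠ 0 := NeZero.ne q
  have H := rels_u q
  simp [sphereGen, spinOne, Fin.sum_univ_three, spinor, Fin.sum_univ_two, add_mul, mul_add,
    smul_mul_assoc, mul_smul_comm, smul_add, smul_smul,
    H.ab, H.ac, H.bd, H.cd, H.bc, H.da, H.ad', h.eq_zero, h.eq_one, h.eq_two]
  match_scalars <;> field_simp; ring

theorem sphereGen_zero (h : Splits q α η ξ r) :
    sphereGen q α 0 = (-q⁻¹ * r) • (spinor q η 1 * spinor q ξ 1) := by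
  have hq : q ≠ 0 := NeZero.ne q
  have H := rels_u q
  simp [sphereGen, spinOne, Fin.sum_univ_three, spinor, Fin.sum_univ_two, add_mul, mul_add,
    smul_mul_assoc, mul_smul_comm, smul_add, smul_smul,
    H.ab, H.ac, H.bd, H.cd, H.bc, H.da, H.ad', h.eq_zero, h.eq_one, h.eq_two]
  match_scalars <;> field_simp; ring

theorem sphereGen_one (h : Splits q α η ξ r) :
    sphereGen q α 1 = (r * (1 + q⁻¹ ^ 2)) • (spinor q η 0 * spinor q ξ 1) +
      algebraMap ℂ _ (α 1 - r * (1 + q⁻¹ ^ 2) * (η 0 * ξ 1)) := by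
  have hq : q ≠ 0 := NeZero.ne q
  have H := rels_u q
  simp [sphereGen, spinOne, Fin.sum_univ_three, spinor, Fin.sum_univ_two, add_mul, mul_add,
    smul_mul_assoc, mul_smul_comm, smul_add, smul_smul, Algebra.algebraMap_eq_smul_one, -map_sub,
    -map_mul, -map_add,
    H.ab, H.ac, H.bd, H.cd, H.bc, H.da, H.ad', h.eq_zero, h.eq_one, h.eq_two]
  match_scalars <;> field_simp <;> ring

/-- The generators give three of the products, the mixed one after division by `1 + q⁻²`; the fourth
follows from the exchange relation `spinor_mul_spinor`. -/
theorem spinor_mul_mem (h : Splits q α η ξ r) (h2 : q ^ 2 + 1 ≠ 0) (i j : Fin 2) :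
    spinor q η i * spinor q ξ j ∈ sphere q α := by
  have hq : q ≠ 0 := NeZero.ne q
  have hr := h.ne_zero
  have h00 : spinor q η 0 * spinor q ξ 0 = r⁻¹ • sphereGen q α 2 := by
    rw [h.sphereGen_two, smul_smul, inv_mul_cancel₀ hr, one_smul]
  have h11 : spinor q η 1 * spinor q ξ 1 = (-q⁻¹ * r)⁻¹ • sphereGen q α 0 := by
    rw [h.sphereGen_zero, smul_smul, inv_mul_cancel₀ (by simp [hq, hr]), one_smul]
  have hr' : r * (1 + q⁻¹ ^ 2) ≠ 0 := by
    refine mul_ne_zero hr fun h0 => h2 ?_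
    field_simp at h0
    simpa using h0
  have h01 : spinor q η 0 * spinor q ξ 1 = (r * (1 + q⁻¹ ^ 2))⁻¹ • (sphereGen q α 1 -
      algebraMap ℂ _ (α 1 - r * (1 + q⁻¹ ^ 2) * (η 0 * ξ 1))) := by
    rw [h.sphereGen_one, add_sub_cancel_right, smul_smul, inv_mul_cancel₀ hr', one_smul]
  have m01 : spinor q η 0 * spinor q ξ 1 ∈ sphere q α := by
    rw [h01]
    exact Subalgebra.smul_mem _ (sub_mem (sphereGen_mem q α 1) (Subalgebra.algebraMap_mem _ _)) _
  have h10 : spinor q η 1 * spinor q ξ 0 = q⁻¹ • (spinor q η 0 * spinor q ξ 1 -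
      algebraMap ℂ _ (η 0 * ξ 1 - q * η 1 * ξ 0)) := by
    rw [spinor_mul_spinor, add_sub_cancel_right, smul_smul, inv_mul_cancel₀ hq, one_smul]
  fin_cases i <;> fin_cases j
  · exact h00 ▸ Subalgebra.smul_mem _ (sphereGen_mem q α 2) _
  · exact m01
  · exact h10 ▸ Subalgebra.smul_mem _ (sub_mem m01 (Subalgebra.algebraMap_mem _ _)) _
  · exact h11 ▸ Subalgebra.smul_mem _ (sphereGen_mem q α 0) _

end Splits

end OSLq

/-! ### Coideals and the passage to the opposite comultiplication. -/

namespace Covariant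

theorem isRightCoideal_adjoin {A : Type} [Ring A] [Bialgebra ℂ A] {S : Set A}
    (hS : ∀ x ∈ S, Coalgebra.comul (R := ℂ) x ∈
      LinearMap.range (LinearMap.rTensor A (Algebra.adjoin ℂ S).val.toLinearMap)) :
    IsRightCoideal (Coalgebra.comul (R := ℂ) (A := A)) (Algebra.adjoin ℂ S) := by
  have h : Algebra.adjoin ℂ S ≤ ((Algebra.TensorProduct.map (Algebra.adjoin ℂ S).val
      (AlgHom.id ℂ A)).range).comap (Bialgebra.comulAlgHom ℂ A) := by
    refine Algebra.adjoin_le fun x hx => ?_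
    obtain ⟨t, ht⟩ := hS x hx
    exact ⟨t, ht⟩
  intro b
  obtain ⟨t, ht⟩ := h b.2
  exact ⟨t, ht⟩

theorem IsRightCoideal.op {A : Type} [Ring A] [Algebra ℂ A] {Δ : A →ₗ[ℂ] A ⊗[ℂ] A}
    {B : Subalgebra ℂ A} (h : IsRightCoideal Δ B) : IsLeftCoideal (opComul Δ) B := by
  intro b
  obtain ⟨t, ht⟩ := h b
  refine ⟨TensorProduct.comm ℂ _ _ t, ?_⟩
  simp only [opComul, LinearMap.comp_apply, ← ht]
  exact LinearMap.congr_fun (LinearMap.lTensor_comp_comm (N := A) B.val.toLinearMap) t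

theorem leftCoact_op {A : Type} [Ring A] [Algebra ℂ A] {Δ : A →ₗ[ℂ] A ⊗[ℂ] A}
    {B : Subalgebra ℂ A} (hR : IsRightCoideal Δ B) (hL : IsLeftCoideal (opComul Δ) B) (b : B) :
    leftCoact hL b = TensorProduct.comm ℂ _ _ (rightCoact hR b) := by
  apply lTensor_val_injective B
  rw [lTensor_leftCoact]
  simp only [opComul, LinearMap.comp_apply, ← rTensor_rightCoact hR]
  exact (LinearMap.congr_fun (LinearMap.lTensor_comp_comm (N := A) B.val.toLinearMap) _).symm

namespace BimoduleDerivation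

theorem IsRightEquivariant.op {A : Type} [Ring A] [Algebra ℂ A] {Δ : A →ₗ[ℂ] A ⊗[ℂ] A}
    {B : Subalgebra ℂ A} {hR : IsRightCoideal Δ B} {δ : BimoduleDerivation B}
    (h : δ.IsRightEquivariant hR) (hL : IsLeftCoideal (opComul Δ) B) :
    δ.IsLeftEquivariant hL := by
  obtain ⟨Φ, hΦ⟩ := h
  refine ⟨(TensorProduct.comm ℂ _ _).toLinearMap ∘ₗ Φ, fun a b => ?_⟩
  rw [LinearMap.comp_apply, hΦ, leftCoact_op hR, leftCoact_op hR]
  generalize rightCoact hR a = s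
  generalize rightCoact hR b = t
  induction s using TensorProduct.induction_on with
  | zero => simp
  | add s s' hs hs' => simp only [map_add, LinearMap.add_apply, ← hs, ← hs']
  | tmul s s' =>
    induction t using TensorProduct.induction_on with
    | zero => simp
    | add t t' ht ht' => simp only [map_add, LinearMap.add_apply, ← ht, ← ht']
    | tmul t t' => simp

end BimoduleDerivation

end Covariant

/-! ### Matrix representations on subquotients. -/

namespace Covariant

/-- If the generators `S` stabilise `W` and act on the basis `v` of a complement modulo `W`, then
the algebra generated by `S` has a matrix representation. -/
theorem exists_matrix_rep {A V ι : Type} [Ring A] [Algebra ℂ A] [AddCommGroup V] [Module ℂ V]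
    [Fintype ι] [DecidableEq ι] (ρ : A →ₐ[ℂ] Module.End ℂ V) (W : Submodule ℂ V) (v : ι → V)
    (l : ι → V →ₗ[ℂ] ℂ) (hlW : ∀ i, ∀ w ∈ W, l i w = 0)
    (hlv : ∀ i j, l i (v j) = if i = j then 1 else 0) {κ : Type} (e : κ → A)
    (m : κ → Matrix ι ι ℂ) (hW : ∀ k, ∀ w ∈ W, ρ (e k) w ∈ W)
    (hm : ∀ k j, ρ (e k) (v j) - ∑ i, m k i j • v i ∈ W) :
    ∃ τ : Algebra.adjoin ℂ (Set.range e) →ₐ[ℂ] Matrix ι ι ℂ,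
      ∀ k (hk : e k ∈ Algebra.adjoin ℂ (Set.range e)), τ ⟨e k, hk⟩ = m k := by
  have hcoef : ∀ x : V, ∀ c : ι → ℂ, x - ∑ i, c i • v i ∈ W → ∀ i, l i x = c i := by
    intro x c hx i
    have := hlW i _ hx
    simp only [map_sub, map_sum, map_smul, hlv, smul_eq_mul, mul_ite, mul_one, mul_zero,
      Finset.sum_ite_eq, Finset.mem_univ, if_true, sub_eq_zero] at this
    exact this
  -- The induction carries two facts: `x` preserves `W`, and it preserves the span of `v` modulo
  -- `W`, with the functionals `l` reading off the matrix.
  have key : ∀ x ∈ Algebra.adjoin ℂ (Set.range e), (∀ w ∈ W, ρ x w ∈ W) ∧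
      ∀ j, ρ x (v j) - ∑ i, l i (ρ x (v j)) • v i ∈ W := by
    intro x hx
    induction hx using Algebra.adjoin_induction with
    | mem x hx =>
      obtain ⟨k, rfl⟩ := hx
      refine ⟨hW k, fun j => ?_⟩
      rw [Finset.sum_congr rfl fun i _ => by rw [hcoef _ _ (hm k j) i]]
      exact hm k j
    | algebraMap c =>
      refine ⟨fun w hw => ?_, fun j => ?_⟩
      · simpa [Module.algebraMap_end_apply] using W.smul_mem c hw
      · simp [Module.algebraMap_end_apply, hlv]
    | add x y _ _ hx hy =>
      refine ⟨fun w hw => ?_, fun j => ?_⟩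
      · simpa using W.add_mem (hx.1 w hw) (hy.1 w hw)
      · have := W.add_mem (hx.2 j) (hy.2 j)
        simp only [map_add, LinearMap.add_apply, add_smul, Finset.sum_add_distrib]
        convert this using 1
        abel
    | mul x y _ _ hx hy =>
      refine ⟨fun w hw => ?_, fun j => ?_⟩
      · simpa using hx.1 _ (hy.1 w hw)
      · obtain ⟨c, w, hw, hyw⟩ : ∃ c : ι → ℂ, ∃ w ∈ W, ρ y (v j) = ∑ i, c i • v i + w :=
          ⟨_, _, hy.2 j, (add_sub_cancel _ _).symm⟩
        have h1 : ρ (x * y) (v j) = ∑ i, c i • ρ x (v i) + ρ x w := by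
          simp only [map_mul, Module.End.mul_apply, hyw, map_add, map_sum, map_smul]
        have h2 : ∑ i, c i • (ρ x (v i) - ∑ k, l k (ρ x (v i)) • v k) + ρ x w ∈ W :=
          W.add_mem (W.sum_mem fun i _ => W.smul_mem _ (hx.2 i)) (hx.1 w hw)
        convert h2 using 1
        rw [h1]
        simp only [map_add, map_sum, map_smul, hlW _ _ (hx.1 w hw), add_zero, smul_sub,
          Finset.sum_sub_distrib, Finset.smul_sum, Finset.sum_smul, smul_smul, smul_eq_mul]
        rw [Finset.sum_comm]
        abel
  refine ⟨AlgHom.ofLinearMap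
    { toFun := fun x => Matrix.of fun i j => l i (ρ x (v j))
      map_add' := fun x y => by ext; simp
      map_smul' := fun c x => by ext; simp } ?_ ?_, fun k hk => ?_⟩
  · ext i j
    simp [hlv, Matrix.one_apply]
  · intro x y
    ext i j
    have hy := (key y y.2).2 j
    have h := hlW i _ ((key x x.2).1 _ hy)
    simp only [map_sub, map_sum, map_smul, sub_eq_zero] at h
    simp [Matrix.mul_apply, h, mul_comm]
  · ext i j
    exact hcoef _ _ (hm k j) i

end Covariant

/-! ### The Laurent polynomial representation and the construction of `τ`. -/

namespace OSLq

/-- The weighted shift `zᵏ ↦ f(k) zᵏ⁺ⁿ` of the Laurent polynomials. -/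
noncomputable def wshift (f : ℤ → ℂ) (n : ℤ) : Module.End ℂ (ℤ →₀ ℂ) :=
  Finsupp.linearCombination ℂ fun k => Finsupp.single (k + n) (f k)

theorem wshift_single (f : ℤ → ℂ) (n k : ℤ) (c : ℂ) :
    wshift f n (Finsupp.single k c) = Finsupp.single (k + n) (f k * c) := by
  simp [wshift, mul_comm]

theorem wshift_mul (f g : ℤ → ℂ) (n m : ℤ) :
    wshift f n * wshift g m = wshift (fun k => f (k + m) * g k) (n + m) := by
  refine Finsupp.lhom_ext fun k c => ?_
  simp [wshift_single, mul_assoc, add_assoc, add_comm n m, -Finsupp.single_mul]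

theorem wshift_one : wshift 1 0 = 1 := by
  refine Finsupp.lhom_ext fun k c => ?_
  simp [wshift_single]

theorem wshift_smul (c : ℂ) (f : ℤ → ℂ) (n : ℤ) : c • wshift f n = wshift (c • f) n := by
  refine Finsupp.lhom_ext fun k c => ?_
  simp [wshift_single, mul_assoc, -Finsupp.single_mul]

theorem wshift_add (f g : ℤ → ℂ) (n : ℤ) : wshift f n + wshift g n = wshift (f + g) n := by
  refine Finsupp.lhom_ext fun k c => ?_
  simp [wshift_single, add_mul]

theorem wshift_mem_supported {f : ℤ → ℂ} {n : ℤ} {s : Set ℤ} (h : ∀ k ∈ s, f k ≠ 0 → k + n ∈ s)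
    {w : ℤ →₀ ℂ} (hw : w ∈ Finsupp.supported ℂ ℂ s) :
    wshift f n w ∈ Finsupp.supported ℂ ℂ s := by
  rw [wshift, Finsupp.linearCombination_apply]
  refine Submodule.sum_mem _ fun k hk => Submodule.smul_mem _ _ ?_
  by_cases hf : f k = 0
  · simp [hf]
  · exact Finsupp.single_mem_supported ℂ _ (h k (hw hk) hf)

/-- The values on the generators of the representation of `O(SL_q(2))` on Laurent polynomials with
`u^2_1 = 0`. -/
noncomputable def laurentGen (q β : ℂ) : Fin 2 → Fin 2 → Module.End ℂ (ℤ →₀ ℂ) :=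
  !![wshift 1 (-1), wshift (fun k => β * q ^ k) 1; 0, wshift 1 1]

theorem rels_laurent (q β : ℂ) [NeZero q] : Rels q (laurentGen q β) := by
  have hq : q ≠ 0 := NeZero.ne q
  constructor <;>
    simp [laurentGen, wshift_mul, wshift_smul] <;> try rfl
  · congr 1
    funext k
    simp [zpow_sub₀ hq, zpow_add₀ hq]
    field_simp
  · congr 1
    funext k
    simp [zpow_sub₀ hq, zpow_add₀ hq]
    ring
  · exact (sub_zero _).trans wshift_one

/-- Once `α₀` is written as `α₁ y (q⁴ + 1)`, the value `c(2)` forces `α₋₁ = -q⁴ y² α₁`. The factors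
then have known sum and product (`hs`, `hp`), and the ratio `ξ₂ / ξ₁` is a root of `t² - (1 + q⁴) y
t + q⁴ y²`, that is `y` or `q⁴ y`. -/
theorem splits_special {q : ℂ} [NeZero q] (h4 : q ^ 4 + 1 ≠ 0) {α : Fin 3 → ℂ} (h1 : α 1 ≠ 0)
    (hc : α 0 * α 2 / α 1 ^ 2 = specialParam q 2) {η ξ : Fin 2 → ℂ} {y r : ℂ} 
    (hy : α 1 = α 2 * (y * (q ^ 4 + 1))) (hr : α 2 = r * η 0 * ξ 0)
    (hs : η 0 * ξ 1 + q⁻¹ * η 1 * ξ 0 = η 0 * ξ 0 * (y * (q ^ 4 + 1)))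
    (hp : η 1 * ξ 1 = q ^ 5 * y ^ 2 * (η 0 * ξ 0)) : Splits q α η ξ r := by
  have hq : q ≠ 0 := NeZero.ne q
  have h2 : α 2 ≠ 0 := by
    rintro h
    rw [hy, h, zero_mul] at h1
    exact h1 rfl
  refine ⟨?_, hr, ?_, ?_⟩
  · rintro rfl
    simp [h2] at hr
  · rw [hs, hy, hr]; ring
  · have e : specialParam q 2 = -q ^ 4 / (q ^ 4 + 1) ^ 2 := by norm_num [specialParam]
    have : α 0 = -q ^ 4 * y ^ 2 * α 2 := by
      rw [e, div_eq_div_iff (pow_ne_zero 2 h1) (pow_ne_zero 2 h4), hy] at hc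
      have h3 : α 2 * (q ^ 4 + 1) ^ 2 ≠ 0 := mul_ne_zero h2 (pow_ne_zero 2 h4)
      refine mul_right_cancel₀ h3 ?_
      linear_combination hc
    rw [this, hr, mul_assoc _ (η 1) (ξ 1), hp]
    field_simp

theorem exists_tau {q : ℂ} [NeZero q] (h2 : q ^ 2 - 1 ≠ 0) (h4 : q ^ 4 + 1 ≠ 0) {α : Fin 3 → ℂ}
    (h1 : α 1 ≠ 0) {y : ℂ} (hy : α 1 = α 2 * (y * (q ^ 4 + 1)))
    (h : Splits q α ![1, q ^ 5 * y] ![1, y] (α 2)) :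
    ∃ τ : sphere q α →ₐ[ℂ] Matrix (Fin 2) (Fin 2) ℂ,
      ∀ i, τ ⟨sphereGen q α i, sphereGen_mem q α i⟩ = tauGen q α i := by
  have hq : q ≠ 0 := NeZero.ne q
  -- With `β = -y` the second component of the spinor `(1, s)` becomes the shift with coefficient `s
  -- - y qᵏ`. This vanishes at `k = 0` for `s = y` and at `k = 5` for `s = q⁵ y`.
  set ρ := lift q _ (rels_laurent q (-y)) with hρ
  have hs0 : ∀ s : ℂ, ρ (spinor q ![1, s] 0) = wshift 1 (-1) := fun s => by
    simp only [hρ, spinor, Fin.sum_univ_two, map_add, map_smul, lift_u]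
    simp [laurentGen]
  have hs1 : ∀ s : ℂ, ρ (spinor q ![1, s] 1) = wshift (fun k => s - y * q ^ k) 1 := fun s => by
    simp only [hρ, spinor, Fin.sum_univ_two, map_add, map_smul, lift_u]
    simp [laurentGen, wshift_smul, wshift_add]
    congr 1
    funext k
    simp; ring
  have e2 : ρ (sphereGen q α 2) = wshift (fun _ => α 2) (-2) := by
    rw [h.sphereGen_two, map_smul, map_mul, hs0, hs0, wshift_mul, wshift_smul]
    congr 1
    funext k
    simp
  have e0 : ρ (sphereGen q α 0) = wshift (fun k => -q⁻¹ * α 2 * y ^ 2 *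
      ((q ^ 5 - q * q ^ k) * (1 - q ^ k))) 2 := by
    rw [h.sphereGen_zero, map_smul, map_mul, hs1, hs1, wshift_mul, wshift_smul]
    congr 1
    funext k
    simp [zpow_add₀ hq]
    ring
  have e1 : ρ (sphereGen q α 1) = wshift (fun k => α 1 - α 2 * (1 + q⁻¹ ^ 2) * y * q ^ k) 0 := by
    rw [h.sphereGen_one, map_add, map_smul, map_mul, hs0, hs1, wshift_mul, wshift_smul,
      AlgHom.commutes, Algebra.algebraMap_eq_smul_one, ← wshift_one, wshift_smul]
    simp only [neg_add_cancel]
    rw [wshift_add]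
    congr 1
    funext k
    simp
    ring
  have h2' : α 2 ≠ 0 := h.ne_zero
  have hy0 : y ≠ 0 := by
    rintro rfl
    simp [hy] at h1
  set κ := (q ^ 2 - 1) / (q ^ 4 + 1) * α 1 with hκ
  have hκ' : κ = (q ^ 2 - 1) * y * α 2 := by
    rw [hκ, hy]; field_simp
  have hκ0 : κ ≠ 0 := by rw [hκ']; simp [h2, hy0, h2']
  -- The vector `z²` is rescaled so that `e₁ z⁴ = α₁ z²` becomes `κ q²` times the second basis
  -- vector.
  set μ : ℂ := α 2 / (κ * q ^ 2) with hμ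
  have hμ0 : μ ≠ 0 := by simp [hμ, h2', hκ0, hq]
  obtain ⟨τ, hτ⟩ := Covariant.exists_matrix_rep ρ
    (Finsupp.supported ℂ ℂ {k : ℤ | k ≤ 0 ∧ Even k})
    ![Finsupp.single 4 1, Finsupp.single 2 μ]
    ![Finsupp.lapply 4, μ⁻¹ • Finsupp.lapply 2]
    (by
      intro i w hw
      rw [Finsupp.mem_supported'] at hw
      fin_cases i <;> simp [hw])
    (by intro i j; fin_cases i <;> fin_cases j <;> simp [hμ0, Finsupp.single_apply])
    (sphereGen q α) (tauGen q α)
    (by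
      intro k w hw
      fin_cases k
      · simp only [Fin.zero_eta, e0]
        refine wshift_mem_supported (fun k hk hf => ?_) hw
        -- The factor `1 - qᵏ` stops `e₋₁` from leading from `z⁰` to `z²`, so the even exponents `≤
        -- 0` span an invariant subspace.
        have : k ≠ 0 := by rintro rfl; simp at hf
        obtain ⟨hk0, m, hm⟩ := hk
        exact ⟨by omega, m + 1, by omega⟩
      · simp only [Fin.mk_one, e1]
        exact wshift_mem_supported (fun k hk _ => by simpa using hk) hw
      · simp only [Fin.reduceFinMk, e2]
        refine wshift_mem_supported (fun k hk _ => ?_) hw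
        obtain ⟨hk0, m, hm⟩ := hk
        exact ⟨by omega, m - 1, by omega⟩)
    (by
      intro k j
      have z4 : (q : ℂ) ^ (4 : ℤ) = q ^ 4 := by norm_cast
      have z2 : (q : ℂ) ^ (2 : ℤ) = q ^ 2 := by norm_cast
      fin_cases k <;> fin_cases j
      -- The factor `q⁵ - q qᵏ` vanishes at `k = 4`, so `e₋₁` kills `z⁴`.
      · simp only [Fin.zero_eta, Fin.reduceFinMk, Fin.mk_one, e0, tauGen, ← hκ]
        simp [wshift_single, z4, z2, -Finsupp.single_mul, -Finsupp.single_sub, -Finsupp.single_add,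
          -Finsupp.single_neg, ← Finsupp.single_sub, ← Finsupp.single_neg, ← Finsupp.single_add]
        convert Submodule.zero_mem _
        rw [Finsupp.single_eq_zero]
        ring
      · simp only [Fin.zero_eta, Fin.reduceFinMk, Fin.mk_one, e0, tauGen, ← hκ]
        simp [wshift_single, z4, z2, -Finsupp.single_mul, -Finsupp.single_sub, -Finsupp.single_add,
          -Finsupp.single_neg, ← Finsupp.single_sub, ← Finsupp.single_neg, ← Finsupp.single_add]
        convert Submodule.zero_mem _
        rw [Finsupp.single_eq_zero]
        simp only [hμ, hκ', hy]
        field_simp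
        ring
      · simp only [Fin.zero_eta, Fin.reduceFinMk, Fin.mk_one, e1, tauGen, ← hκ]
        simp [wshift_single, z4, z2, -Finsupp.single_mul, -Finsupp.single_sub, -Finsupp.single_add,
          -Finsupp.single_neg, ← Finsupp.single_sub, ← Finsupp.single_neg, ← Finsupp.single_add]
        convert Submodule.zero_mem _
        rw [Finsupp.single_eq_zero]
        simp only [hμ, hκ', hy]
        field_simp
        ring
      · simp only [Fin.zero_eta, Fin.reduceFinMk, Fin.mk_one, e1, tauGen, ← hκ]
        simp [wshift_single, z4, z2, -Finsupp.single_mul, -Finsupp.single_sub, -Finsupp.single_add,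
          -Finsupp.single_neg, ← Finsupp.single_sub, ← Finsupp.single_neg, ← Finsupp.single_add]
        convert Submodule.zero_mem _
        rw [Finsupp.single_eq_zero]
        simp only [hμ, hκ', hy]
        field_simp
        ring
      · simp only [Fin.zero_eta, Fin.reduceFinMk, Fin.mk_one, e2, tauGen, ← hκ]
        simp [wshift_single, z4, z2, -Finsupp.single_mul, -Finsupp.single_sub, -Finsupp.single_add,
          -Finsupp.single_neg, ← Finsupp.single_sub, ← Finsupp.single_neg, ← Finsupp.single_add]
        convert Submodule.zero_mem _
        rw [Finsupp.single_eq_zero]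
        simp only [hμ, hκ', hy]
        field_simp
        ring
      -- `e₁` sends `z²` to a multiple of `z⁰`, which is zero in the quotient.
      · simp only [Fin.zero_eta, Fin.reduceFinMk, Fin.mk_one, e2, tauGen, ← hκ]
        simp [wshift_single, z4, z2, -Finsupp.single_mul, -Finsupp.single_sub, -Finsupp.single_add,
          -Finsupp.single_neg, ← Finsupp.single_sub, ← Finsupp.single_neg, ← Finsupp.single_add]
        exact Finsupp.single_mem_supported ℂ _ ⟨le_rfl, by simp⟩)
  exact ⟨τ, fun i => hτ i _⟩

end OSLq

/-! ### Equivariance of inner derivations. -/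

namespace Covariant

section
variable {A : Type} [Ring A] [Algebra ℂ A] {B : Subalgebra ℂ A}

/-- The homomorphism `B ⊗ A → M₂(A)`, `b ⊗ a ↦ τ(b) a`. -/
noncomputable def slice (τ : B →ₐ[ℂ] Matrix (Fin 2) (Fin 2) ℂ) :
    B ⊗[ℂ] A →ₐ[ℂ] Matrix (Fin 2) (Fin 2) A :=
  Algebra.TensorProduct.lift ((Algebra.ofId ℂ A).mapMatrix.comp τ)
    (Matrix.scalarAlgHom (Fin 2) ℂ) (by
      intro b a
      ext i j
      simp [Algebra.ofId_apply, Algebra.commutes])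

theorem slice_tmul (τ : B →ₐ[ℂ] Matrix (Fin 2) (Fin 2) ℂ) (b : B) (a : A) (i j : Fin 2) :
    slice τ (b ⊗ₜ a) i j = τ b i j • a := by
  refine (congrArg (fun M : Matrix (Fin 2) (Fin 2) A => M i j)
    (Algebra.TensorProduct.lift_tmul _ _ _ b a)).trans ?_
  simp [Algebra.ofId_apply, Algebra.smul_def, Matrix.mul_apply, Matrix.scalar_apply,
    Matrix.diagonal_apply]

section
variable (τ : B →ₐ[ℂ] Matrix (Fin 2) (Fin 2) ℂ) (x : Fin 2 → A)

/-- The coordinates of an element of the bimodule of `innerDerivation τ x`. -/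
def innerCoord (i : Fin 2) : (innerDerivation τ x).M →ₗ[ℂ] A where
  toFun m := (m : Fin 2 → A) i
  map_add' _ _ := rfl
  map_smul' _ _ := rfl

/-- The element `γⁱ a` of the bimodule of `innerDerivation τ x`. -/
def innerSingle (i : Fin 2) : A →ₗ[ℂ] (innerDerivation τ x).M where
  toFun a := (Pi.single i a : Fin 2 → A)
  map_add' a b := Pi.single_add (f := fun _ : Fin 2 => A) i a b
  map_smul' c a := Pi.single_smul (f := fun _ : Fin 2 => A) i c a

/-- The element `ω = ∑ γⁱ xᵢ` of the bimodule of `innerDerivation τ x`. -/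
def innerForm : (innerDerivation τ x).M := Twisted.mk τ x

theorem innerDerivation_d (b : B) : (innerDerivation τ x).d b =
    MulOpposite.op b • innerForm τ x - b • innerForm τ x := rfl

theorem innerCoord_smul (i : Fin 2) (a : B) (m : (innerDerivation τ x).M) :
    innerCoord τ x i (a • m) = ∑ j, τ a i j • innerCoord τ x j m := rfl

theorem innerCoord_op_smul (i : Fin 2) (b : B) (m : (innerDerivation τ x).M) :
    innerCoord τ x i (MulOpposite.op b • m) = innerCoord τ x i m * b := rfl

theorem innerCoord_d (i : Fin 2) (b : B) :
    innerCoord τ x i ((innerDerivation τ x).d b) = x i * b - ∑ j, τ b i j • x j := rfl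

theorem innerCoord_single (i j : Fin 2) (a : A) :
    innerCoord τ x i (innerSingle τ x j a) = if i = j then a else 0 :=
  Pi.single_apply (M := A) j a i

theorem inner_ext {m m' : (innerDerivation τ x).M}
    (h : ∀ i, innerCoord τ x i m = innerCoord τ x i m') : m = m' := funext h

theorem sum_innerSingle_innerCoord (m : (innerDerivation τ x).M) :
    ∑ i, innerSingle τ x i (innerCoord τ x i m) = m := by
  refine inner_ext τ x fun i => ?_
  fin_cases i <;> simp [innerCoord_single]

/-- The maps `m ⊗ a ↦ mᵢ ⊗ a` for a subspace of the bimodule of `innerDerivation τ x`. -/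
noncomputable def coordTensor (N : Submodule ℂ (innerDerivation τ x).M) :
    N ⊗[ℂ] A →ₗ[ℂ] Fin 2 → A ⊗[ℂ] A :=
  LinearMap.pi fun i => LinearMap.rTensor A (innerCoord τ x i ∘ₗ N.subtype)

theorem coordTensor_tmul (N : Submodule ℂ (innerDerivation τ x).M) (n : N) (a : A) (i : Fin 2) :
    coordTensor τ x N (n ⊗ₜ a) i = innerCoord τ x i n ⊗ₜ a := rfl

/-- Reassembling the coordinates after `coordTensor` gives the inclusion of `N ⊗ A` into `M ⊗ A`,
which is injective by flatness. Identities in `Γ(δ) ⊗ A` may therefore be checked in coordinates in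
`A ⊗ A`. -/
theorem coordTensor_injective (N : Submodule ℂ (innerDerivation τ x).M) :
    Function.Injective (coordTensor τ x N) := by
  have h : (∑ i, LinearMap.rTensor A (innerSingle τ x i) ∘ₗ LinearMap.proj i) ∘ₗ
      coordTensor τ x N = LinearMap.rTensor A N.subtype := by
    refine TensorProduct.ext' fun n a => ?_
    simp only [LinearMap.comp_apply, LinearMap.sum_apply, LinearMap.proj_apply, coordTensor_tmul,
      LinearMap.rTensor_tmul, ← TensorProduct.sum_tmul, sum_innerSingle_innerCoord]
    rfl
  have h' : Function.Injective (LinearMap.rTensor A N.subtype) :=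
    Module.Flat.rTensor_preserves_injective_linearMap _ Subtype.val_injective
  rw [← h, LinearMap.coe_comp] at h'
  exact Function.Injective.of_comp h'

end

end

section
variable {A : Type} [Ring A] [Bialgebra ℂ A] {B : Subalgebra ℂ A}

/-- The homomorphism `Δ : B → B ⊗ A` of a right coideal subalgebra. -/
noncomputable def rightCoactHom (hB : IsRightCoideal (Coalgebra.comul (R := ℂ) (A := A)) B) :
    B →ₐ[ℂ] B ⊗[ℂ] A :=
  AlgHom.ofLinearMap (rightCoact hB)
    (rTensor_val_injective B (by
      rw [rTensor_rightCoact]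
      simp [Algebra.TensorProduct.one_def]))
    (fun a b => rTensor_val_injective B (by
      have h : ∀ s t : B ⊗[ℂ] A, LinearMap.rTensor A B.val.toLinearMap (s * t) =
          LinearMap.rTensor A B.val.toLinearMap s * LinearMap.rTensor A B.val.toLinearMap t :=
        map_mul (Algebra.TensorProduct.map B.val (AlgHom.id ℂ A))
      rw [h, rTensor_rightCoact, rTensor_rightCoact, rTensor_rightCoact]
      simp))

variable {τ : B →ₐ[ℂ] Matrix (Fin 2) (Fin 2) ℂ}

section
variable (τ) (x : Fin 2 → A)

/-- The map `∑ γʲ mⱼ ↦ ∑ γᵏ mⱼ₍₁₎ ⊗ Vₖⱼ mⱼ₍₂₎`. -/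
noncomputable def innerCoact (V : Matrix (Fin 2) (Fin 2) A) :
    (innerDerivation τ x).M →ₗ[ℂ] Fin 2 → A ⊗[ℂ] A :=
  LinearMap.pi fun k => ∑ j, LinearMap.mulLeft ℂ (1 ⊗ₜ[ℂ] V k j) ∘ₗ
    Coalgebra.comul ∘ₗ innerCoord τ x j

theorem innerCoact_apply (V : Matrix (Fin 2) (Fin 2) A) (m : (innerDerivation τ x).M)
    (k : Fin 2) : innerCoact τ x V m k =
      ∑ j, 1 ⊗ₜ[ℂ] V k j * Coalgebra.comul (R := ℂ) (innerCoord τ x j m) := by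
  simp [innerCoact]

/-- The hypothesis `hV` is the compatibility of the left action on the `γʲ` with their coaction: it
lets `τ(a)` pass through `V` and reappear as `τ(a₍₁₎) a₍₂₎`. -/
theorem innerCoact_smul (hB : IsRightCoideal (Coalgebra.comul (R := ℂ) (A := A)) B)
    {V : Matrix (Fin 2) (Fin 2) A} {a : B}
    (hV : ∀ k n, ∑ l, slice τ (rightCoact hB a) k l * V l n = ∑ j, τ a j n • V k j)
    (m : (innerDerivation τ x).M) (k : Fin 2) : innerCoact τ x V (a • m) k =
      ∑ l, 1 ⊗ₜ[ℂ] slice τ (rightCoact hB a) k l * innerCoact τ x V m l := by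
  have h0 := congrArg (fun z : A => (1 : A) ⊗ₜ[ℂ] z) (hV k 0)
  have h1 := congrArg (fun z : A => (1 : A) ⊗ₜ[ℂ] z) (hV k 1)
  simp only [Fin.sum_univ_two, TensorProduct.tmul_add, TensorProduct.tmul_smul] at h0 h1
  have hm : ∀ x y : A, (1 : A) ⊗ₜ[ℂ] (x * y) = (1 ⊗ₜ[ℂ] x) * (1 ⊗ₜ[ℂ] y) := fun x y => by simp
  rw [hm, hm] at h0 h1
  simp only [innerCoact_apply, innerCoord_smul, Fin.sum_univ_two, map_add, map_smul,
    mul_add, mul_smul_comm, ← mul_assoc]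
  generalize innerCoord τ x 0 m = m0
  generalize innerCoord τ x 1 m = m1
  calc _ = (τ a 0 0 • 1 ⊗ₜ[ℂ] V k 0 + τ a 1 0 • 1 ⊗ₜ[ℂ] V k 1) * Coalgebra.comul (R := ℂ) m0 +
        (τ a 0 1 • 1 ⊗ₜ[ℂ] V k 0 + τ a 1 1 • 1 ⊗ₜ[ℂ] V k 1) * Coalgebra.comul (R := ℂ) m1 := by
        simp only [add_mul, smul_mul_assoc]; abel
    _ = _ := by
        rw [← h0, ← h1]
        simp only [add_mul]; abel

theorem innerCoact_op_smul (V : Matrix (Fin 2) (Fin 2) A) (b : B)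
    (m : (innerDerivation τ x).M) (k : Fin 2) : innerCoact τ x V (MulOpposite.op b • m) k =
      innerCoact τ x V m k * Coalgebra.comul (R := ℂ) (b : A) := by
  simp [innerCoact_apply, innerCoord_op_smul, add_mul, mul_assoc]

/-- The coordinates of the prescribed value `a₍₁₎ δb₍₁₎ ⊗ a₍₂₎ b₍₂₎`, put in the form to which
`innerCoact` evaluates on `a δb` when `ω` is invariant. -/
theorem coordTensor_map₂ (s t : B ⊗[ℂ] A) (k : Fin 2) :
    coordTensor τ x _ (TensorProduct.map₂ (innerDerivation τ x).mulDGam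
      (LinearMap.mul ℂ A) s t) k =
    ∑ l, 1 ⊗ₜ[ℂ] slice τ s k l * (x l ⊗ₜ[ℂ] 1 * LinearMap.rTensor A B.val.toLinearMap t -
      ∑ n, 1 ⊗ₜ[ℂ] slice τ t l n * x n ⊗ₜ[ℂ] 1) := by
  induction s using TensorProduct.induction_on with
  | zero => simp
  | add s s' hs hs' =>
    simp only [map_add, LinearMap.add_apply, Pi.add_apply, hs, hs', Matrix.add_apply,
      TensorProduct.tmul_add, add_mul, Finset.sum_add_distrib]
  | tmul a a' =>
    induction t using TensorProduct.induction_on with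
    | zero => simp
    | add t t' ht ht' =>
      simp only [map_add, LinearMap.add_apply, Pi.add_apply, ht, ht', Matrix.add_apply,
        TensorProduct.tmul_add, add_mul, mul_add, Finset.sum_add_distrib, Fin.sum_univ_two,
        mul_sub]
      abel
    | tmul b b' =>
      have h : TensorProduct.map₂ (innerDerivation τ x).mulDGam (LinearMap.mul ℂ A)
          (a ⊗ₜ a') (b ⊗ₜ b') = (innerDerivation τ x).mulDGam a b ⊗ₜ (a' * b') := rfl
      rw [h, coordTensor_tmul, BimoduleDerivation.coe_mulDGam, innerCoord_smul]
      simp only [innerCoord_d, slice_tmul, LinearMap.rTensor_tmul,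
        Algebra.TensorProduct.tmul_mul_tmul,
        TensorProduct.tmul_smul, Fin.sum_univ_two, TensorProduct.add_tmul,
        TensorProduct.sub_tmul, ← TensorProduct.smul_tmul', smul_sub, smul_add, mul_sub, mul_add,
        smul_mul_assoc, mul_smul_comm, one_mul, mul_one, LinearMap.mul_apply',
        AlgHom.toLinearMap_apply, Subalgebra.coe_val]
      module

/-- An inner derivation is equivariant if `ω` is invariant for a compatible coaction. -/
theorem innerDerivation_isRightEquivariant
    (hB : IsRightCoideal (Coalgebra.comul (R := ℂ) (A := A)) B) (V : Matrix (Fin 2) (Fin 2) A)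
    (hV : ∀ a k n, ∑ l, slice τ (rightCoact hB a) k l * V l n = ∑ j, τ a j n • V k j)
    (hx : ∀ k, ∑ j, 1 ⊗ₜ[ℂ] V k j * Coalgebra.comul (R := ℂ) (x j) = x k ⊗ₜ[ℂ] 1) :
    (innerDerivation τ x).IsRightEquivariant hB := by
  have hx' : ∀ k, innerCoact τ x V (innerForm τ x) k = x k ⊗ₜ[ℂ] 1 := fun k =>
    (innerCoact_apply τ x V _ k).trans (hx k)
  have h2 : ∀ a b : B, innerCoact τ x V ((innerDerivation τ x).mulD (a ⊗ₜ b)) =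
      coordTensor τ x _ (TensorProduct.map₂ (innerDerivation τ x).mulDGam (LinearMap.mul ℂ A)
        (rightCoact hB a) (rightCoact hB b)) := by
    intro a b
    funext k
    rw [coordTensor_map₂, BimoduleDerivation.mulD_tmul, innerCoact_smul τ x hB (hV a)]
    refine Finset.sum_congr rfl fun l _ => ?_
    rw [innerDerivation_d, map_sub, Pi.sub_apply, innerCoact_op_smul,
      innerCoact_smul τ x hB (hV b), rTensor_rightCoact]
    simp only [hx']
  have h3 : ∀ g : (innerDerivation τ x).Gam, innerCoact τ x V g ∈
      LinearMap.range (coordTensor τ x (innerDerivation τ x).Gam) := by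
    rintro ⟨_, t, rfl⟩
    change innerCoact τ x V ((innerDerivation τ x).mulD t) ∈ _
    induction t using TensorProduct.induction_on with
    | zero => simp
    | add t t' ht ht' => simpa only [map_add] using add_mem ht ht'
    | tmul a b => exact ⟨_, (h2 a b).symm⟩
  refine ⟨(LinearEquiv.ofInjective _ (coordTensor_injective τ x _)).symm.toLinearMap ∘ₗ
    LinearMap.codRestrict _ (innerCoact τ x V ∘ₗ (innerDerivation τ x).Gam.subtype) h3,
    fun a b => ?_⟩
  apply coordTensor_injective τ x
  rw [← h2]
  exact congrArg Subtype.val ((LinearEquiv.ofInjective _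
    (coordTensor_injective τ x _)).apply_symm_apply _)

end

end

end Covariant

/-! ### Equivariance on the quantum sphere. -/

namespace OSLq

namespace Splits
variable {q : ℂ} [NeZero q] {α : Fin 3 → ℂ} {η ξ : Fin 2 → ℂ} {r : ℂ}

/-- The product `ηᵢ ξⱼ` of two spinors as an element of the quantum sphere. -/
noncomputable def prod (h : Splits q α η ξ r) (h2 : q ^ 2 + 1 ≠ 0) (i j : Fin 2) : sphere q α :=
  ⟨spinor q η i * spinor q ξ j, h.spinor_mul_mem h2 i j⟩

theorem gen_two (h : Splits q α η ξ r) (h2 : q ^ 2 + 1 ≠ 0) :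
    (⟨sphereGen q α 2, sphereGen_mem q α 2⟩ : sphere q α) = r • h.prod h2 0 0 :=
  Subtype.ext h.sphereGen_two

theorem gen_zero (h : Splits q α η ξ r) (h2 : q ^ 2 + 1 ≠ 0) :
    (⟨sphereGen q α 0, sphereGen_mem q α 0⟩ : sphere q α) = (-q⁻¹ * r) • h.prod h2 1 1 :=
  Subtype.ext h.sphereGen_zero

theorem gen_one (h : Splits q α η ξ r) (h2 : q ^ 2 + 1 ≠ 0) :
    (⟨sphereGen q α 1, sphereGen_mem q α 1⟩ : sphere q α) =
      (r * (1 + q⁻¹ ^ 2)) • h.prod h2 0 1 +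
        algebraMap ℂ _ (α 1 - r * (1 + q⁻¹ ^ 2) * (η 0 * ξ 1)) :=
  Subtype.ext h.sphereGen_one

theorem prod_zero_one (h : Splits q α η ξ r) (h2 : q ^ 2 + 1 ≠ 0) : h.prod h2 0 1 =
    q • h.prod h2 1 0 + algebraMap ℂ _ (η 0 * ξ 1 - q * η 1 * ξ 0) :=
  Subtype.ext (spinor_mul_spinor q η ξ)

theorem comul_prod (i j : Fin 2) : Coalgebra.comul (R := ℂ) (spinor q η i * spinor q ξ j) =
    ∑ k, ∑ l, (spinor q η k * spinor q ξ l) ⊗ₜ[ℂ] (u q k i * u q l j) := by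
  simp only [Bialgebra.comul_mul, comul_spinor, Finset.sum_mul_sum,
    Algebra.TensorProduct.tmul_mul_tmul]

theorem isRightCoideal (h : Splits q α η ξ r) (h2 : q ^ 2 + 1 ≠ 0) :
    Covariant.IsRightCoideal (Coalgebra.comul (R := ℂ) (A := OSLq q)) (sphere q α) := by
  refine Covariant.isRightCoideal_adjoin ?_
  have key : ∀ i j, Coalgebra.comul (R := ℂ) (spinor q η i * spinor q ξ j) ∈
      LinearMap.range (LinearMap.rTensor (OSLq q) (sphere q α).val.toLinearMap) := by
    intro i j
    rw [comul_prod]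
    exact Submodule.sum_mem _ fun k _ => Submodule.sum_mem _ fun l _ =>
      ⟨h.prod h2 k l ⊗ₜ (u q k i * u q l j), rfl⟩
  have key' : ∀ c, Coalgebra.comul (R := ℂ) (algebraMap ℂ (OSLq q) c) ∈
      LinearMap.range (LinearMap.rTensor (OSLq q) (sphere q α).val.toLinearMap) :=
    fun c => ⟨algebraMap ℂ (sphere q α) c ⊗ₜ 1, by
      simp [Algebra.TensorProduct.algebraMap_apply]⟩
  rintro _ ⟨i, rfl⟩
  fin_cases i
  · simp only [Fin.zero_eta, h.sphereGen_zero, map_smul]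
    exact Submodule.smul_mem _ _ (key 1 1)
  · simp only [Fin.mk_one, h.sphereGen_one, map_smul, map_add]
    exact Submodule.add_mem _ (Submodule.smul_mem _ _ (key 0 1)) (key' _)
  · simp only [Fin.reduceFinMk, h.sphereGen_two, map_smul]
    exact Submodule.smul_mem _ _ (key 0 0)

theorem rightCoact_prod (h : Splits q α η ξ r) (h2 : q ^ 2 + 1 ≠ 0)
    (hR : Covariant.IsRightCoideal (Coalgebra.comul (R := ℂ) (A := OSLq q)) (sphere q α))
    (i j : Fin 2) : Covariant.rightCoact hR (h.prod h2 i j) =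
      ∑ k, ∑ l, h.prod h2 k l ⊗ₜ[ℂ] (u q k i * u q l j) := by
  apply Covariant.rTensor_val_injective
  rw [Covariant.rTensor_rightCoact]
  simp only [map_sum]
  exact comul_prod i j

end Splits

/-- The matrix with entries `S⁻¹(u^j_k)`. -/
noncomputable def skewMatrix (q : ℂ) : Matrix (Fin 2) (Fin 2) (OSLq q) :=
  !![u q 1 1, -q⁻¹ • u q 1 0; -q • u q 0 1, u q 0 0]

theorem transpose_mul_skewMatrix (q : ℂ) [NeZero q] :
    (Matrix.of fun j l => u q l j) * skewMatrix q = 1 := by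
  have hq : q ≠ 0 := NeZero.ne q
  have H := rels_u q
  ext i j
  fin_cases i <;> fin_cases j <;>
    simp [Matrix.mul_apply, skewMatrix, H.ab, H.ac, H.bd, H.cd, H.bc, H.da, H.ad', smul_smul, hq]

theorem skewMatrix_spinor (q : ℂ) [NeZero q] (ξ : Fin 2 → ℂ) (k : Fin 2) :
    ∑ j, 1 ⊗ₜ[ℂ] skewMatrix q k j * Coalgebra.comul (R := ℂ) (spinor q ξ j) =
      spinor q ξ k ⊗ₜ[ℂ] 1 := by
  have hq : q ≠ 0 := NeZero.ne q
  have H := rels_u q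
  have hVU : ∀ l, skewMatrix q k 0 * u q l 0 + skewMatrix q k 1 * u q l 1 =
      if k = l then 1 else 0 := by
    intro l
    fin_cases k <;> fin_cases l <;>
      simp [skewMatrix, H.ab, H.ac, H.bd, H.cd, H.bc, H.da, H.ad', smul_smul, hq]
  simp only [comul_spinor, Fin.sum_univ_two, mul_add, Algebra.TensorProduct.tmul_mul_tmul, one_mul]
  calc _ = spinor q ξ 0 ⊗ₜ[ℂ] (skewMatrix q k 0 * u q 0 0 + skewMatrix q k 1 * u q 0 1) +
        spinor q ξ 1 ⊗ₜ[ℂ] (skewMatrix q k 0 * u q 1 0 + skewMatrix q k 1 * u q 1 1) := by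
        simp only [TensorProduct.tmul_add]; abel
    _ = _ := by
        rw [hVU, hVU]
        fin_cases k <;> simp

/-- The values of `τ` on the products of the spinors that define the quantum sphere. -/
noncomputable def tauProd (q y : ℂ) : Fin 2 → Fin 2 → Matrix (Fin 2) (Fin 2) ℂ :=
  !![!![0, 0; y * (q ^ 2 - 1) * q ^ 2, 0], !![y * (1 - q ^ 4), 0; 0, y * (1 - q ^ 2)];
    !![y * (q ^ 5 - q ^ 3), 0; 0, y * (q ^ 5 - q)], !![0, -q * y * (q ^ 2 - 1); 0, 0]]

section
variable {q : ℂ} [NeZero q] {α : Fin 3 → ℂ} {y : ℂ}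

/-- The generators are affine functions of the products of spinors, so their prescribed images
determine `τ` on those products; the entry `(1, 0)` comes from the exchange relation. -/
theorem tau_prod (h2 : q ^ 2 + 1 ≠ 0) (h4 : q ^ 4 + 1 ≠ 0)
    (hy : α 1 = α 2 * (y * (q ^ 4 + 1)))
    (h : Splits q α ![1, q ^ 5 * y] ![1, y] (α 2))
    {τ : sphere q α →ₐ[ℂ] Matrix (Fin 2) (Fin 2) ℂ}
    (hτ : ∀ i, τ ⟨sphereGen q α i, sphereGen_mem q α i⟩ = tauGen q α i) (i j : Fin 2) :
    τ (h.prod h2 i j) = tauProd q y i j := by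
  have hq : q ≠ 0 := NeZero.ne q
  have hr := h.ne_zero
  have hr' : α 2 * (1 + q⁻¹ ^ 2) ≠ 0 := by
    refine mul_ne_zero hr fun h0 => h2 ?_
    field_simp at h0
    simpa using h0
  have e2 := hτ 2
  have e1 := hτ 1
  have e0 := hτ 0
  rw [h.gen_two h2, map_smul] at e2
  rw [h.gen_zero h2, map_smul] at e0
  rw [h.gen_one h2, map_add, map_smul, AlgHom.commutes] at e1
  have e10 := congrArg τ (h.prod_zero_one h2)
  rw [map_add, map_smul, AlgHom.commutes] at e10
  have e01 : τ (h.prod h2 0 1) = tauProd q y 0 1 := by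
    ext m n
    have := congrFun (congrFun e1 m) n
    refine mul_left_cancel₀ hr' ?_
    simp only [Matrix.add_apply, Matrix.smul_apply, smul_eq_mul] at this
    refine (eq_sub_of_add_eq this).trans ?_
    fin_cases m <;> fin_cases n <;>
      simp [tauGen, tauProd, hy, Matrix.algebraMap_matrix_apply] <;> field_simp <;> ring
  rw [e01] at e10
  fin_cases i <;> fin_cases j
  · ext m n
    have := congrFun (congrFun e2 m) n
    refine mul_left_cancel₀ hr (this.trans ?_)
    fin_cases m <;> fin_cases n <;> simp [tauGen, tauProd, hy] <;> field_simp
  · exact e01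
  · ext m n
    have := congrFun (congrFun e10 m) n
    simp only [Matrix.add_apply, Matrix.smul_apply, smul_eq_mul] at this
    refine mul_left_cancel₀ hq ((eq_sub_of_add_eq this.symm).trans ?_)
    fin_cases m <;> fin_cases n <;>
      simp [tauProd, Matrix.algebraMap_matrix_apply] <;> ring
  · ext m n
    have := congrFun (congrFun e0 m) n
    refine mul_left_cancel₀ (mul_ne_zero (neg_ne_zero.2 (inv_ne_zero hq)) hr) (this.trans ?_)
    fin_cases m <;> fin_cases n <;> simp [tauGen, tauProd, hy] <;> field_simp

/-- This is the covariance of `τ`: coacting on the products of spinors amounts to conjugating their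
matrices, as `skewMatrix` is inverse to the transpose of `u`. It is a finite check, made by ordering
the monomials in each entry. -/
theorem slice_prod (h2 : q ^ 2 + 1 ≠ 0) (h : Splits q α ![1, q ^ 5 * y] ![1, y] (α 2))
    {τ : sphere q α →ₐ[ℂ] Matrix (Fin 2) (Fin 2) ℂ}
    (hτ : ∀ i j, τ (h.prod h2 i j) = tauProd q y i j)
    (hR : Covariant.IsRightCoideal (Coalgebra.comul (R := ℂ) (A := OSLq q)) (sphere q α))
    (i j : Fin 2) : Covariant.slice τ (Covariant.rightCoact hR (h.prod h2 i j)) =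
      skewMatrix q * (tauProd q y i j).map (algebraMap ℂ (OSLq q)) *
        (Matrix.of fun j l => u q l j) := by
  have hq : q ≠ 0 := NeZero.ne q
  have H := rels_u q
  rw [h.rightCoact_prod h2]
  ext m n
  trans ∑ k, ∑ l, tauProd q y k l m n • (u q k i * u q l j)
  · simp only [map_sum, Matrix.sum_apply, ← hτ]
    exact Finset.sum_congr rfl fun k _ => Finset.sum_congr rfl fun l _ =>
      Covariant.slice_tmul τ _ _ m n
  simp only [Matrix.mul_apply, Fin.sum_univ_two, Matrix.of_apply, Matrix.map_apply,
    Algebra.algebraMap_eq_smul_one]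
  fin_cases i <;> fin_cases j <;> fin_cases m <;> fin_cases n <;>
  · simp [skewMatrix, tauProd, H.ab, H.ac, H.bd, H.cd, H.bc, H.da, H.ad', smul_smul]
    try (match_scalars <;> field_simp <;> ring)

/-- Both `slice τ ∘ Δ` and the scalar extension of `τ` are algebra homomorphisms, so the
intertwining relation spreads from the products of spinors to the algebra they generate. -/
theorem slice_mul_skewMatrix (h2 : q ^ 2 + 1 ≠ 0)
    (h : Splits q α ![1, q ^ 5 * y] ![1, y] (α 2))
    {τ : sphere q α →ₐ[ℂ] Matrix (Fin 2) (Fin 2) ℂ}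
    (hτ : ∀ i j, τ (h.prod h2 i j) = tauProd q y i j)
    (hR : Covariant.IsRightCoideal (Coalgebra.comul (R := ℂ) (A := OSLq q)) (sphere q α))
    (a : sphere q α) : Covariant.slice τ (Covariant.rightCoact hR a) * skewMatrix q =
      skewMatrix q * (τ a).map (algebraMap ℂ (OSLq q)) := by
  set T := (Covariant.slice τ).comp (Covariant.rightCoactHom hR) with hT
  set σ := (Algebra.ofId ℂ (OSLq q)).mapMatrix.comp τ with hσ
  change T a * skewMatrix q = skewMatrix q * σ a
  have hp : ∀ i j, T (h.prod h2 i j) * skewMatrix q = skewMatrix q * σ (h.prod h2 i j) := by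
    intro i j
    refine (congrArg (· * skewMatrix q) (slice_prod h2 h hτ hR i j)).trans ?_
    rw [mul_assoc, transpose_mul_skewMatrix, mul_one, ← hτ]
    rfl
  have hadd : ∀ x y, T x * skewMatrix q = skewMatrix q * σ x →
      T y * skewMatrix q = skewMatrix q * σ y →
      T (x + y) * skewMatrix q = skewMatrix q * σ (x + y) := fun x y hx hy => by
    rw [map_add, map_add, add_mul, mul_add, hx, hy]
  have hsmul : ∀ (c : ℂ) x, T x * skewMatrix q = skewMatrix q * σ x →
      T (c • x) * skewMatrix q = skewMatrix q * σ (c • x) := fun c x hx => by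
    rw [map_smul, map_smul, smul_mul_assoc, mul_smul_comm, hx]
  have halg : ∀ c, T (algebraMap ℂ _ c) * skewMatrix q = skewMatrix q * σ (algebraMap ℂ _ c) :=
    fun c => by rw [AlgHom.commutes, AlgHom.commutes, Algebra.commutes]
  obtain ⟨a, ha⟩ := a
  induction ha using Algebra.adjoin_induction with
  | mem x hx =>
    obtain ⟨i, rfl⟩ := hx
    fin_cases i
    · exact (h.gen_zero h2).symm ▸ hsmul _ _ (hp 1 1)
    · exact (h.gen_one h2).symm ▸ hadd _ _ (hsmul _ _ (hp 0 1)) (halg _)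
    · exact (h.gen_two h2).symm ▸ hsmul _ _ (hp 0 0)
  | algebraMap c => exact halg c
  | add x y hx hy ihx ihy => exact hadd ⟨x, hx⟩ ⟨y, hy⟩ ihx ihy
  | mul x y hx hy ihx ihy =>
    change T (⟨x, hx⟩ * ⟨y, hy⟩) * _ = _ * σ (⟨x, hx⟩ * ⟨y, hy⟩)
    rw [map_mul, map_mul, mul_assoc, ihy, ← mul_assoc, ihx, mul_assoc]

/-- `skewMatrix` depends neither on `τ` nor on `ξ`, and it makes `ω` invariant for every spinor. The
special ratios of `ξ` matter only for the dimensions. -/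
theorem innerDerivation_spinor_isRightEquivariant (h2 : q ^ 2 + 1 ≠ 0)
    (h : Splits q α ![1, q ^ 5 * y] ![1, y] (α 2))
    {τ : sphere q α →ₐ[ℂ] Matrix (Fin 2) (Fin 2) ℂ}
    (hτ : ∀ i j, τ (h.prod h2 i j) = tauProd q y i j)
    (hR : Covariant.IsRightCoideal (Coalgebra.comul (R := ℂ) (A := OSLq q)) (sphere q α))
    (ξ : Fin 2 → ℂ) : (Covariant.innerDerivation τ (spinor q ξ)).IsRightEquivariant hR := by
  refine Covariant.innerDerivation_isRightEquivariant τ _ hR (skewMatrix q) (fun a k n => ?_)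
    (skewMatrix_spinor q ξ)
  have := congrFun (congrFun (slice_mul_skewMatrix h2 h hτ hR a) k) n
  simp only [Matrix.mul_apply, Matrix.map_apply] at this
  rw [this]
  exact Finset.sum_congr rfl fun j _ => by rw [← Algebra.commutes, Algebra.smul_def]

end

end OSLq

/-! ### Left and right dimension. -/

namespace Covariant

namespace BimoduleDerivation
variable {B : Type} [Ring B] [Algebra ℂ B] (δ : BimoduleDerivation B)

theorem smul_d_mem_Gam (a b : B) : a • δ.d b ∈ δ.Gam := ⟨a ⊗ₜ b, δ.mulD_tmul a b⟩

theorem leftDim_eq_zero {φ : B →ₐ[ℂ] ℂ} {b : B} (hφ : φ b = 0) (hb : ∀ m : δ.M, b • m = m) :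
    δ.leftDim φ = 0 := by
  have h : δ.leftAug φ = ⊤ := by
    refine eq_top_iff.2 fun g _ => Submodule.subset_span ⟨b, hφ, g, g.2, (hb g).symm⟩
  have : Subsingleton (δ.Gam ⧸ δ.leftAug φ) := Submodule.Quotient.subsingleton_iff.2 h
  exact rank_subsingleton' _ _

theorem op_smul_mem_span {φ : B →ₐ[ℂ] ℂ} {b : B} (hφ : φ b = 0) {g : δ.M} (hg : g ∈ δ.Gam) :
    MulOpposite.op b • g ∈ Submodule.span ℂ {m : δ.M | ∃ b : B, φ b = 0 ∧ ∃ g ∈ δ.Gam,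
      m = MulOpposite.op b • g} :=
  Submodule.subset_span ⟨b, hφ, g, hg, rfl⟩

end BimoduleDerivation

section
variable {A : Type} [Ring A] [Algebra ℂ A] {B : Subalgebra ℂ A}
  (τ : B →ₐ[ℂ] Matrix (Fin 2) (Fin 2) ℂ) (x : Fin 2 → A)

theorem smul_eq_self_of_tau_eq_one {b : B} (hb : τ b = 1) (m : (innerDerivation τ x).M) :
    b • m = m := by
  refine inner_ext τ x fun i => ?_
  rw [innerCoord_smul, hb]
  simp only [Matrix.one_apply, ite_smul, one_smul, zero_smul, Finset.sum_ite_eq, Finset.mem_univ,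
    if_true]

/-- In `a (ω c - c ω)` the left actions contribute only scalar matrices, so the coordinates stay in
`x₁ B + x₂ B`. -/
theorem exists_coord_eq {g : (innerDerivation τ x).M} (hg : g ∈ (innerDerivation τ x).Gam)
    (i : Fin 2) : ∃ b : Fin 2 → B, innerCoord τ x i g = ∑ j, x j * b j := by
  obtain ⟨t, rfl⟩ := hg
  induction t using TensorProduct.induction_on with
  | zero => exact ⟨0, by simp⟩
  | add t t' ht ht' =>
    obtain ⟨b, hb⟩ := ht
    obtain ⟨b', hb'⟩ := ht'
    exact ⟨b + b', by simp [hb, hb', mul_add]; abel⟩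
  | tmul a c =>
    refine ⟨fun l => τ a i l • c - algebraMap ℂ B ((τ a * τ c) i l), ?_⟩
    rw [BimoduleDerivation.mulD_tmul, innerCoord_smul]
    simp only [innerCoord_d, Fin.sum_univ_two, Matrix.mul_apply, AddSubgroupClass.coe_sub,
      Subalgebra.coe_smul, Subalgebra.coe_algebraMap, mul_sub, Algebra.algebraMap_eq_smul_one,
      Subalgebra.coe_add, Subalgebra.coe_one, mul_add, mul_smul_comm, mul_one, smul_sub, smul_add, smul_smul, add_smul]
    abel

/-- If `τ n = 0` then `δ n = ω n`, and an `a` that `τ` maps to the matrix unit `(i, j)` picks out `a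
ω n = γⁱ xⱼ n`. -/
theorem innerSingle_mem_Gam (hτ : Function.Surjective τ) (i j : Fin 2) {n : B} (hn : τ n = 0) :
    innerSingle τ x i (x j * n) ∈ (innerDerivation τ x).Gam := by
  obtain ⟨a, ha⟩ := hτ (Matrix.single i j 1)
  convert (innerDerivation τ x).smul_d_mem_Gam a n using 1
  refine inner_ext τ x fun l => ?_
  rw [innerCoord_smul, innerCoord_single]
  simp only [innerCoord_d, hn, ha, Matrix.zero_apply, zero_smul, Finset.sum_const_zero, sub_zero,
    Matrix.single_apply]
  fin_cases i <;> fin_cases j <;> fin_cases l <;> simp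

theorem op_smul_innerSingle (i : Fin 2) (a : A) (b : B) :
    MulOpposite.op b • innerSingle τ x i a = innerSingle τ x i (a * b) := by
  refine inner_ext τ x fun l => ?_
  rw [innerCoord_op_smul, innerCoord_single, innerCoord_single]
  split_ifs <;> simp

/-- The derivation `a ↦ ω a - a ω` has right dimension `2` at `φ` if `x₁ B + x₂ B` is a projective
`B`-module with fibre of dimension `1` at `φ`, and `φ` vanishes on a normal element of `B` that
`τ` maps to an invertible matrix. -/
theorem rightDim_innerDerivation (hτ : Function.Surjective τ) (y : Fin 2 → A)
    (hyx : ∀ i j, y i * x j ∈ B) (hxy : x 0 * y 0 + x 1 * y 1 = 1) (φ : B →ₐ[ℂ] ℂ)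
    (h0 : φ ⟨_, hyx 0 0⟩ ≠ 0)
    (hdet : φ ⟨_, hyx 0 0⟩ * φ ⟨_, hyx 1 1⟩ = φ ⟨_, hyx 0 1⟩ * φ ⟨_, hyx 1 0⟩)
    {Z g : B} (hZ : φ Z = 0) (hnormal : ∀ m, ∃ m', Z * m = m' * Z) (hg : τ Z * τ g = 1) :
    (innerDerivation τ x).rightDim φ = 2 := by
  have hmem : ∀ m ∈ (innerDerivation τ x).Gam, ∀ i j, y j * innerCoord τ x i m ∈ B := by
    intro m hm i j
    obtain ⟨b, hb⟩ := exists_coord_eq τ x hm i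
    rw [hb, Finset.mul_sum]
    refine sum_mem fun l _ => ?_
    rw [← mul_assoc]
    exact mul_mem (hyx j l) (b l).2
  -- The candidate for the fibre map: left multiplication by `y 0` carries the coordinates into `B`,
  -- where `φ` can be evaluated. Its kernel is shown to be `Γ (ker φ)`.
  let Λ : (innerDerivation τ x).Gam →ₗ[ℂ] Fin 2 → ℂ :=
    { toFun := fun m i => φ ⟨y 0 * innerCoord τ x i m, hmem m m.2 i 0⟩
      map_add' := fun m m' => by
        funext i
        rw [Pi.add_apply, ← map_add]
        congr 1
        exact Subtype.ext (by simp [mul_add])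
      map_smul' := fun c m => by
        funext i
        rw [Pi.smul_apply, RingHom.id_apply, ← map_smul]
        congr 1
        exact Subtype.ext (by simp) }
  have hΛ : ∀ m i, Λ m i = φ ⟨y 0 * innerCoord τ x i m, hmem m m.2 i 0⟩ := fun _ _ => rfl
  -- `f` lies in `ker τ` but `φ f = 1`, so it separates the point `φ` from the representation `τ`.
  set f : B := 1 - Z * g with hf
  have hφf : φ f = 1 := by simp [hf, hZ]
  have hτf : τ f = 0 := by simp [hf, hg]
  have hsurj : Function.Surjective Λ := by
    intro c
    refine ⟨∑ i, ⟨innerSingle τ x i (x 0 * ((c i / φ ⟨_, hyx 0 0⟩) • f : B)),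
      innerSingle_mem_Gam τ x hτ i 0 (by simp [hτf])⟩, ?_⟩
    funext i
    have : φ (⟨_, hyx 0 0⟩ * ((c i / φ ⟨_, hyx 0 0⟩) • f)) = c i := by
      rw [map_mul, map_smul, hφf, smul_eq_mul]
      field_simp
    rw [hΛ, ← this]
    congr 1
    refine Subtype.ext ?_
    fin_cases i <;> simp [innerCoord_single, mul_assoc]
  have hker : LinearMap.ker Λ = (innerDerivation τ x).rightAug φ := by
    ext m
    rw [LinearMap.mem_ker]
    constructor
    · intro hm
      set k : Fin 2 → Fin 2 → B := fun i j => ⟨y j * innerCoord τ x i m, hmem m m.2 i j⟩ with hk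
      have hk0 : ∀ i, φ (k i 0) = 0 := fun i => congrFun hm i
      have hkφ : ∀ i j, φ (k i j) = 0 := by
        intro i j
        obtain ⟨b, hb⟩ := exists_coord_eq τ x m.2 i
        have hkb : ∀ j, φ (k i j) =
            φ ⟨_, hyx j 0⟩ * φ (b 0) + φ ⟨_, hyx j 1⟩ * φ (b 1) := by
          intro j
          rw [← map_mul, ← map_mul, ← map_add]
          congr 1
          refine Subtype.ext ?_
          simp [hk, hb, mul_add, mul_assoc]
        fin_cases j
        · exact hk0 i
        · have := hk0 i
          rw [hkb] at this
          refine (mul_eq_zero.1 ?_).resolve_left h0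
          change φ ⟨_, hyx 0 0⟩ * φ (k i 1) = 0
          rw [hkb]
          -- At `φ` the matrix `(yᵢ xⱼ)` has vanishing determinant and nonzero first entry, so its
          -- second row is a multiple of the first; hence the vanishing of `k i 0` forces that of `k
          -- i 1`.
          linear_combination φ ⟨_, hyx 1 0⟩ * this + φ (b 1) * hdet
      -- Split `1 = Z g + f` on the right; `m Z g` already lies in `Γ (ker φ)`, and `m f` is
      -- expanded with `∑ xⱼ yⱼ = 1`.
      have hdec : (m : (innerDerivation τ x).M) = MulOpposite.op (Z * g) • m.1 +
          ∑ i, ∑ j, innerSingle τ x i (x j * (k i j * f : B)) := by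
        have h1 : (m : (innerDerivation τ x).M) =
            MulOpposite.op (Z * g) • m.1 + MulOpposite.op f • m.1 := by
          rw [← add_smul, ← MulOpposite.op_add, hf, add_sub_cancel, MulOpposite.op_one, one_smul]
        have h2 : MulOpposite.op f • m.1 =
            ∑ i, ∑ j, innerSingle τ x i (x j * (k i j * f : B)) := by
          refine inner_ext τ x fun l => ?_
          have h3 : innerCoord τ x l m.1 = ∑ j, x j * (k l j : A) := by
            simp only [hk, Fin.sum_univ_two, ← mul_assoc, ← add_mul, hxy, one_mul]
          rw [innerCoord_op_smul, h3]
          simp only [map_sum, innerCoord_single]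
          fin_cases l <;> simp [add_mul, mul_assoc]
        rw [← h2]
        exact h1
      change m.1 ∈ Submodule.span ℂ _
      rw [hdec]
      refine add_mem (BimoduleDerivation.op_smul_mem_span _ (by simp [hZ]) m.2)
        (sum_mem fun i _ => sum_mem fun j _ => ?_)
      set n : B := k i j * f with hn
      have hnφ : φ n = 0 := by simp [hn, hkφ]
      have hnτ : τ n = 0 := by simp [hn, hτf]
      -- The aim is to write `n` in `ker τ ∩ ker φ` as an element of `(ker τ)(ker φ)`, namely `n = f
      -- n + m' Z`. Invertibility of `τ Z` gives `τ m' = 0`.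
      obtain ⟨m', hm'⟩ := hnormal (g * n)
      have hm'τ : τ m' = 0 := by
        have := congrArg τ hm'
        rw [map_mul τ Z, map_mul τ g, map_mul τ m', hnτ, mul_zero, mul_zero] at this
        rw [← mul_one (τ m'), ← hg, ← mul_assoc, ← this, zero_mul]
      have hn' : n = f * n + m' * Z := by
        rw [← hm', hf, sub_mul, one_mul, mul_assoc, sub_add_cancel]
      have hs : innerSingle τ x i (x j * (n : A)) =
          MulOpposite.op n • innerSingle τ x i (x j * f) +
            MulOpposite.op Z • innerSingle τ x i (x j * m') := by
        rw [op_smul_innerSingle, op_smul_innerSingle, ← map_add]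
        congr 1
        conv_lhs => rw [hn']
        simp [mul_add, mul_assoc]
      rw [hs]
      exact add_mem
        (BimoduleDerivation.op_smul_mem_span _ hnφ (innerSingle_mem_Gam τ x hτ i j hτf))
        (BimoduleDerivation.op_smul_mem_span _ hZ (innerSingle_mem_Gam τ x hτ i j hm'τ))
    · intro hm
      have key : ∀ z ∈ Submodule.span ℂ {m : (innerDerivation τ x).M | ∃ b : B, φ b = 0 ∧
          ∃ g ∈ (innerDerivation τ x).Gam, m = MulOpposite.op b • g},
          ∀ i, ∃ b : B, φ b = 0 ∧ y 0 * innerCoord τ x i z = b := by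
        intro z hz i
        induction hz using Submodule.span_induction with
        | mem z hz =>
          obtain ⟨b, hb, g, hg, rfl⟩ := hz
          exact ⟨⟨_, hmem g hg i 0⟩ * b, by simp [hb], by
            simp [innerCoord_op_smul, mul_assoc]⟩
        | zero => exact ⟨0, by simp, by simp⟩
        | add z z' _ _ hz hz' =>
          obtain ⟨b, hb, e⟩ := hz
          obtain ⟨b', hb', e'⟩ := hz'
          exact ⟨b + b', by simp [hb, hb'], by simp [mul_add, e, e']⟩
        | smul c z _ hz =>
          obtain ⟨b, hb, e⟩ := hz
          exact ⟨c • b, by simp [hb], by simp [e]⟩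
      funext i
      obtain ⟨b, hb, e⟩ := key m hm i
      rw [hΛ, Pi.zero_apply, ← hb]
      congr 1
      exact Subtype.ext e
  have := (Λ.quotKerEquivOfSurjective hsurj).rank_eq
  rw [hker, rank_fin_fun] at this
  exact_mod_cast this

end

end Covariant

/-! ### Derivations arising from right ideals. -/

namespace Covariant

section
variable {A : Type} [Ring A] [Algebra ℂ A] {B : Subalgebra ℂ A} {Δ : A →ₗ[ℂ] A ⊗[ℂ] A}

theorem lid_rTensor_leftCoact (hB : IsLeftCoideal Δ B) {ε : A →ₐ[ℂ] ℂ}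
    (hε : ∀ a, TensorProduct.lid ℂ A (LinearMap.rTensor A ε.toLinearMap (Δ a)) = a) (b : B) :
    TensorProduct.lid ℂ B (LinearMap.rTensor B ε.toLinearMap (leftCoact hB b)) = b := by
  refine Subtype.ext ((?_ : _ = _).trans (hε b))
  rw [← lTensor_leftCoact hB]
  generalize leftCoact hB b = t
  induction t using TensorProduct.induction_on with
  | zero => simp
  | add t t' ht ht' => simp only [map_add, Subalgebra.coe_add, ht, ht']
  | tmul a b => simp

/-- The counit in the first factor removes the coaction and so recovers `p` from `δ_R`. -/
theorem lid_rTensor_idealMap (hB : IsLeftCoideal Δ B) {ε : A →ₐ[ℂ] ℂ}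
    (hε : ∀ a, TensorProduct.lid ℂ A (LinearMap.rTensor A ε.toLinearMap (Δ a)) = a)
    (R : Submodule ℂ (augKer ε B)) (a b : B) :
    TensorProduct.lid ℂ _ (LinearMap.rTensor _ ε.toLinearMap (idealMap hB R (a ⊗ₜ b))) =
      ε a • R.mkQ (plus ε B b) := by
  conv_rhs => rw [← lid_rTensor_leftCoact hB hε b]
  simp only [idealMap, TensorProduct.lift.tmul, LinearMap.compl₂_apply, LinearMap.comp_apply]
  generalize leftCoact hB b = t
  induction t using TensorProduct.induction_on with
  | zero => simp
  | add t t' ht ht' => simp only [map_add, smul_add, ht, ht']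
  | tmul c d => simp [smul_smul]

/-- If an element of `B⁺` acts as the identity on the bimodule of `δ`, then `δ` can only be of the
form `δ_R` if it vanishes. -/
theorem ArisesFrom.Gam_eq_bot {hB : IsLeftCoideal Δ B} {ε : A →ₐ[ℂ] ℂ}
    (hε : ∀ a, TensorProduct.lid ℂ A (LinearMap.rTensor A ε.toLinearMap (Δ a)) = a)
    {δ : BimoduleDerivation B} {R : Submodule ℂ (augKer ε B)} (h : ArisesFrom hB δ R)
    {b : B} (hb : ε b = 0) (hδ : ∀ m : δ.M, b • m = m) : δ.Gam = ⊥ := by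
  have hp : ∀ c, R.mkQ (plus ε B c) = 0 := by
    intro c
    have hc : (b - 1) ⊗ₜ[ℂ] c ∈ LinearMap.ker δ.mulD := by
      rw [LinearMap.mem_ker, BimoduleDerivation.mulD_tmul, sub_smul, hδ, one_smul, sub_self]
    rw [h, LinearMap.mem_ker] at hc
    -- Here `ε(b - 1) = -1`, so the vanishing of `(b - 1) δc` forces `p(c⁺) = 0`.
    have := lid_rTensor_idealMap hB hε R (b - 1) c
    rw [hc] at this
    simpa [hb] using this.symm
  have hp' : R.mkQ ∘ₗ plus ε B = 0 := LinearMap.ext hp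
  have hz : idealMap hB R = 0 := TensorProduct.ext' fun a c => by simp [idealMap, hp']
  rw [BimoduleDerivation.Gam, LinearMap.range_eq_bot, ← LinearMap.ker_eq_top, h, hz,
    LinearMap.ker_zero]

end

theorem lid_rTensor_opComul {A : Type} [Ring A] [Bialgebra ℂ A] (a : A) :
    TensorProduct.lid ℂ A (LinearMap.rTensor A (Bialgebra.counitAlgHom ℂ A).toLinearMap
      (opComul (Coalgebra.comul (R := ℂ) (A := A)) a)) = a := by
  have h : ∀ t : A ⊗[ℂ] A, LinearMap.rTensor A (Bialgebra.counitAlgHom ℂ A).toLinearMap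
      (TensorProduct.comm ℂ A A t) = TensorProduct.comm ℂ A ℂ
        (LinearMap.lTensor A (Coalgebra.counit (R := ℂ) (A := A)) t) := fun t => by
    induction t using TensorProduct.induction_on with
    | zero => simp
    | add t t' ht ht' => simp only [map_add, ht, ht']
    | tmul a b => simp
  simp only [opComul, LinearMap.comp_apply]
  refine (congrArg _ (h _)).trans ?_
  simp

theorem OneToOneCorrespondence.congr {A : Type} [Ring A] [Algebra ℂ A] {B : Subalgebra ℂ A}
    {Δ Δ' : A →ₗ[ℂ] A ⊗[ℂ] A} (h : Δ = Δ') {ε : A →ₐ[ℂ] ℂ} {hB : IsLeftCoideal Δ B}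
    {hB' : IsLeftCoideal Δ' B} (H : OneToOneCorrespondence hB ε) :
    OneToOneCorrespondence hB' ε := by
  subst h
  exact H

end Covariant

/-! ### The Hopf algebra with the opposite comultiplication. -/

namespace OSLq
variable (q : ℂ) [NeZero q]

/-- The values of the inverse of the antipode on the `u^i_j`. -/
noncomputable def skewAntipodeGen : Fin 2 → Fin 2 → (OSLq q)ᵐᵒᵖ :=
  !![MulOpposite.op (u q 1 1), MulOpposite.op (-q • u q 0 1);
    MulOpposite.op (-q⁻¹ • u q 1 0), MulOpposite.op (u q 0 0)]

theorem rels_skewAntipode : Rels q (skewAntipodeGen q) := by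
  have hq : q ≠ 0 := NeZero.ne q
  have h := rels_u q
  constructor <;> apply MulOpposite.unop_injective <;>
  · simp [skewAntipodeGen, h.ab, h.ac, h.bd, h.cd, h.bc, h.da, h.ad', smul_smul]
    try (match_scalars <;> field_simp <;> ring)

/-- The inverse of the antipode of `O(SL_q(2))`. -/
noncomputable def skewAntipode : OSLq q →ₗ[ℂ] OSLq q :=
  (MulOpposite.opLinearEquiv ℂ).symm.toLinearMap ∘ₗ
    (lift q (skewAntipodeGen q) (rels_skewAntipode q)).toLinearMap

theorem skewAntipode_u (i j : Fin 2) :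
    skewAntipode q (u q i j) = (skewAntipodeGen q i j).unop := by
  simp [skewAntipode]

theorem skewAntipode_mul (x y : OSLq q) :
    skewAntipode q (x * y) = skewAntipode q y * skewAntipode q x := by
  simp [skewAntipode]

theorem antipode_skewAntipode (x : OSLq q) : antipode q (skewAntipode q x) = x := by
  have hq : q ≠ 0 := NeZero.ne q
  induction x using induct with
  | h0 r => simp [skewAntipode, antipode]
  | hu i j =>
    fin_cases i <;> fin_cases j <;>
      simp [skewAntipode_u, skewAntipodeGen, antipode_u, antipodeGen, smul_smul, hq]
  | hadd x y hx hy => rw [map_add, map_add, hx, hy]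
  | hmul x y hx hy =>
    rw [skewAntipode_mul, antipode_mul, hx, hy]

theorem skewAntipode_antipode (x : OSLq q) : skewAntipode q (antipode q x) = x := by
  have hq : q ≠ 0 := NeZero.ne q
  induction x using induct with
  | h0 r => simp [skewAntipode, antipode]
  | hu i j =>
    fin_cases i <;> fin_cases j <;>
      simp [skewAntipode_u, skewAntipodeGen, antipode_u, antipodeGen, smul_smul, hq]
  | hadd x y hx hy => rw [map_add, map_add, hx, hy]
  | hmul x y hx hy =>
    rw [antipode_mul, skewAntipode_mul, hx, hy]

theorem antipode_injective : Function.Injective (antipode q) :=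
  Function.LeftInverse.injective (skewAntipode_antipode q)

/-- The opposite comultiplication of `O(SL_q(2))` as a homomorphism of algebras. -/
noncomputable def opComulHom : OSLq q →ₐ[ℂ] OSLq q ⊗[ℂ] OSLq q :=
  (Algebra.TensorProduct.comm ℂ (OSLq q) (OSLq q)).toAlgHom.comp (Bialgebra.comulAlgHom ℂ (OSLq q))

theorem opComulHom_u (i j : Fin 2) : opComulHom q (u q i j) = ∑ k, u q k j ⊗ₜ[ℂ] u q i k := by
  have : Bialgebra.comulAlgHom ℂ (OSLq q) (u q i j) = ∑ k, u q i k ⊗ₜ[ℂ] u q k j := comul_u q i j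
  simp only [opComulHom, AlgHom.comp_apply]
  erw [this]
  simp

/-- The bialgebra `O(SL_q(2))` with the opposite comultiplication. -/
@[reducible]
noncomputable def copBialgebra : Bialgebra ℂ (OSLq q) :=
  Bialgebra.ofAlgHom (opComulHom q) (lift q _ (rels_counit q))
    (algHom_ext fun i j => by
      simp [opComulHom_u, TensorProduct.add_tmul, TensorProduct.tmul_add]
      abel)
    (algHom_ext fun i j => by
      fin_cases i <;> fin_cases j <;> simp [opComulHom_u])
    (algHom_ext fun i j => by
      fin_cases i <;> fin_cases j <;> simp [opComulHom_u])

/-- The Hopf algebra `O(SL_q(2))` with the opposite comultiplication. -/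
@[reducible]
noncomputable def copHopfAlgebra : HopfAlgebra ℂ (OSLq q) where
  __ := copBialgebra q
  antipode := skewAntipode q
  mul_antipode_rTensor_comul := by
    -- Applying the injective anti-homomorphism `S` turns the axiom for `S⁻¹` and the flipped
    -- comultiplication into the axiom for `S`.
    have h : ∀ t : OSLq q ⊗[ℂ] OSLq q, antipode q (LinearMap.mul' ℂ (OSLq q)
        ((skewAntipode q).rTensor _ (Algebra.TensorProduct.comm ℂ (OSLq q) (OSLq q) t))) =
        LinearMap.mul' ℂ (OSLq q) ((antipode q).rTensor _ t) := by
      intro t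
      induction t using TensorProduct.induction_on with
      | zero => simp
      | add t t' ht ht' => simp only [map_add, ht, ht']
      | tmul a b => simp [antipode_mul, antipode_skewAntipode]
    refine LinearMap.ext fun x => antipode_injective q ((h _).trans ?_)
    exact (LinearMap.congr_fun (HopfAlgebra.mul_antipode_rTensor_comul (R := ℂ)) x).trans
      (antipode_algebraMap q _).symm
  mul_antipode_lTensor_comul := by
    have h : ∀ t : OSLq q ⊗[ℂ] OSLq q, antipode q (LinearMap.mul' ℂ (OSLq q)
        ((skewAntipode q).lTensor _ (Algebra.TensorProduct.comm ℂ (OSLq q) (OSLq q) t))) =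
        LinearMap.mul' ℂ (OSLq q) ((antipode q).lTensor _ t) := by
      intro t
      induction t using TensorProduct.induction_on with
      | zero => simp
      | add t t' ht ht' => simp only [map_add, ht, ht']
      | tmul a b => simp [antipode_mul, antipode_skewAntipode]
    refine LinearMap.ext fun x => antipode_injective q ((h _).trans ?_)
    exact (LinearMap.congr_fun (HopfAlgebra.mul_antipode_lTensor_comul (R := ℂ)) x).trans
      (antipode_algebraMap q _).symm

theorem copHopfAlgebra_comul :
    (copHopfAlgebra q).toCoalgebra.comul = Covariant.opComul (Coalgebra.comul (R := ℂ)) := rfl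

end OSLq

/-! ### Classical points and the normal element. -/

namespace OSLq

/-- Here `a, b, c, d` are the values of a character on the products `(0,0), (0,1), (1,0), (1,1)` of
spinors, with `t = η 0 * ξ 1` and `s = η 1 * ξ 0`. If `c ≠ s`, then `a = 0`, and the remaining
relations leave only the two excluded ratios of `s` and `t`. -/
theorem eq_of_quadratic_relations {q a b c d s t : ℂ} (h2 : q ^ 2 - 1 ≠ 0)
    (hts : t ≠ q * s) (hst : s ≠ q ^ 3 * t) (hb : b = q * c + (t - q * s))
    (h00 : a * c = q * (b * a) + (s - q * t) * a) (h01 : a * d = q * (b * b) + (s - q * t) * b)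
    (h10 : c * c = q * (d * a) + (s - q * t) * c) : c = s := by
  by_contra hcs
  have hD : c - s ≠ 0 := sub_ne_zero.2 hcs
  have ha : a = 0 := by
    have : (q ^ 2 - 1) * (c - s) * a = 0 := by rw [hb] at h00; linear_combination -h00
    exact (mul_eq_zero.1 this).resolve_left (mul_ne_zero h2 hD)
  have e1 : (q * (c - s) + t) * (q ^ 2 * (c - s) + s) = 0 := by
    rw [ha, hb] at h01; linear_combination -h01
  have e2 : c * (c - s + q * t) = 0 := by rw [ha] at h10; linear_combination h10
  rcases mul_eq_zero.1 e1 with e | e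
  · have ht : t = -q * (c - s) := by linear_combination e
    rcases mul_eq_zero.1 e2 with e' | e'
    · exact hts (by rw [ht, e']; ring)
    · exact mul_ne_zero h2 hD (by rw [ht] at e'; linear_combination -e')
  · have hs : s = -q ^ 2 * (c - s) := by linear_combination e
    rcases mul_eq_zero.1 e2 with e' | e'
    · exact mul_ne_zero h2 hD (by linear_combination e - e')
    · exact hst (by linear_combination e - q ^ 2 * e')

namespace Splits
variable {q : ℂ} [NeZero q] {α : Fin 3 → ℂ} {η ξ : Fin 2 → ℂ} {r : ℂ}

/-- The exchange relation is applied to the two inner factors `ξ₀ η₁` of `(ηᵢ ξ₀)(η₁ ξⱼ)`. -/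
theorem prod_mul_prod (h : Splits q α η ξ r) (h2 : q ^ 2 + 1 ≠ 0) (i j : Fin 2) :
    h.prod h2 i 0 * h.prod h2 1 j = q • (h.prod h2 i 1 * h.prod h2 0 j) +
      (η 1 * ξ 0 - q * (η 0 * ξ 1)) • h.prod h2 i j := by
  refine Subtype.ext ?_
  have e := congrArg (fun z => spinor q η i * z * spinor q ξ j) (spinor_mul_spinor q ξ η)
  simp only [Algebra.algebraMap_eq_smul_one, mul_add, add_mul, mul_smul_comm, smul_mul_assoc,
    mul_one] at e
  simp only [prod, MulMemClass.mk_mul_mk, Subalgebra.coe_add, Subalgebra.coe_smul]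
  refine Eq.trans ?_ (e.trans ?_)
  · simp only [mul_assoc]
  · simp only [mul_assoc]
    congr 2
    ring

/-- The values of a classical point of the quantum sphere. -/
theorem classical_point (h : Splits q α η ξ r) (h2 : q ^ 2 + 1 ≠ 0) (h2' : q ^ 2 - 1 ≠ 0)
    (hts : η 0 * ξ 1 ≠ q * (η 1 * ξ 0)) (hst : η 1 * ξ 0 ≠ q ^ 3 * (η 0 * ξ 1))
    (φ : sphere q α →ₐ[ℂ] ℂ) :
    φ (h.prod h2 1 0) = η 1 * ξ 0 ∧ φ (h.prod h2 0 1) = η 0 * ξ 1 ∧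
      φ (h.prod h2 0 0) * φ (h.prod h2 1 1) = φ (h.prod h2 0 1) * φ (h.prod h2 1 0) := by
  have hq : q ≠ 0 := NeZero.ne q
  have hb : φ (h.prod h2 0 1) =
      q * φ (h.prod h2 1 0) + (η 0 * ξ 1 - q * (η 1 * ξ 0)) := by
    rw [h.prod_zero_one h2, map_add, map_smul, AlgHom.commutes, smul_eq_mul, Algebra.algebraMap_self,
      RingHom.id_apply, mul_assoc q]
  have hij : ∀ i j, φ (h.prod h2 i 0) * φ (h.prod h2 1 j) =
      q * (φ (h.prod h2 i 1) * φ (h.prod h2 0 j)) +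
        (η 1 * ξ 0 - q * (η 0 * ξ 1)) * φ (h.prod h2 i j) := by
    intro i j
    rw [← map_mul, h.prod_mul_prod h2, map_add, map_smul, map_smul, map_mul, smul_eq_mul,
      smul_eq_mul]
  have hc := eq_of_quadratic_relations h2' hts hst hb (hij 0 0) (hij 0 1) (hij 1 0)
  have hb' : φ (h.prod h2 0 1) = η 0 * ξ 1 := by rw [hb, hc]; ring
  exact ⟨hc, hb', by rw [hij, hb', hc]; ring⟩

/-- The element `e₀ - α₀` of the quantum sphere. -/
noncomputable def normalElement (q : ℂ) (α : Fin 3 → ℂ) : sphere q α :=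
  ⟨sphereGen q α 1, sphereGen_mem q α 1⟩ - algebraMap ℂ _ (α 1)

theorem normalElement_eq (h : Splits q α η ξ r) (h2 : q ^ 2 + 1 ≠ 0) : normalElement q α =
    (r * (1 + q⁻¹ ^ 2)) • (h.prod h2 0 1 - algebraMap ℂ _ (η 0 * ξ 1)) := by
  rw [normalElement, h.gen_one h2, map_sub, map_mul, Algebra.smul_def, Algebra.smul_def]
  noncomm_ring

theorem apply_normalElement (h : Splits q α η ξ r) (h2 : q ^ 2 + 1 ≠ 0) (h2' : q ^ 2 - 1 ≠ 0)
    (hts : η 0 * ξ 1 ≠ q * (η 1 * ξ 0)) (hst : η 1 * ξ 0 ≠ q ^ 3 * (η 0 * ξ 1))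
    (φ : sphere q α →ₐ[ℂ] ℂ) : φ (normalElement q α) = 0 := by
  rw [h.normalElement_eq h2, map_smul, map_sub, AlgHom.commutes,
    (h.classical_point h2 h2' hts hst φ).2.1]
  simp

/-- Up to scale the element is `N`, which commutes with the middle generator and q-commutes with the
other two, with factors `q⁻²` and `q²`. -/
theorem exists_normalElement_mul (h : Splits q α η ξ r) (h2 : q ^ 2 + 1 ≠ 0) (m : sphere q α) :
    ∃ m', normalElement q α * m = m' * normalElement q α := by
  have hq : q ≠ 0 := NeZero.ne q
  set N := h.prod h2 0 1 - algebraMap ℂ _ (η 0 * ξ 1) with hN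
  have h10 : h.prod h2 1 0 = q⁻¹ • (h.prod h2 0 1 -
      algebraMap ℂ _ (η 0 * ξ 1 - q * η 1 * ξ 0)) := by
    rw [h.prod_zero_one h2, add_sub_cancel_right, smul_smul, inv_mul_cancel₀ hq, one_smul]
  have h0 : N * h.prod h2 0 0 = (q⁻¹ ^ 2 • h.prod h2 0 0) * N := by
    have := h.prod_mul_prod h2 0 0
    simp only [h10, hN, Algebra.algebraMap_eq_smul_one, mul_sub, sub_mul, mul_smul_comm,
      smul_mul_assoc, mul_one, one_mul, smul_sub, smul_smul] at this ⊢
    linear_combination (norm := skip) (-q⁻¹) • this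
    match_scalars <;> field_simp <;> ring
  have h1 : N * h.prod h2 1 1 = (q ^ 2 • h.prod h2 1 1) * N := by
    have := h.prod_mul_prod h2 1 1
    simp only [h10, hN, Algebra.algebraMap_eq_smul_one, mul_sub, sub_mul, mul_smul_comm,
      smul_mul_assoc, mul_one, one_mul, smul_sub, smul_smul] at this ⊢
    linear_combination (norm := skip) q • this
    match_scalars <;> field_simp <;> ring
  have key : ∃ m', N * m = m' * N := by
    obtain ⟨m, hm⟩ := m
    induction hm using Algebra.adjoin_induction with
    | mem x hx =>
      obtain ⟨i, rfl⟩ := hx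
      fin_cases i
      · refine ⟨(-q⁻¹ * r) • (q ^ 2 • h.prod h2 1 1), ?_⟩
        refine (congrArg (N * ·) (h.gen_zero h2)).trans ?_
        rw [mul_smul_comm, smul_mul_assoc, h1]
      · refine ⟨⟨sphereGen q α 1, sphereGen_mem q α 1⟩, ?_⟩
        refine (congrArg (N * ·) (h.gen_one h2)).trans ?_
        refine Eq.trans ?_ (congrArg (· * N) (h.gen_one h2)).symm
        simp only [hN, Algebra.algebraMap_eq_smul_one, mul_add, add_mul, mul_sub, sub_mul,
          mul_smul_comm, smul_mul_assoc, mul_one, one_mul]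
        module
      · refine ⟨r • (q⁻¹ ^ 2 • h.prod h2 0 0), ?_⟩
        refine (congrArg (N * ·) (h.gen_two h2)).trans ?_
        rw [mul_smul_comm, smul_mul_assoc, h0]
    | algebraMap c => exact ⟨algebraMap ℂ _ c, (Algebra.commutes c N).symm⟩
    | add x y hx hy ihx ihy =>
      obtain ⟨m, hm⟩ := ihx
      obtain ⟨m', hm'⟩ := ihy
      refine ⟨m + m', ?_⟩
      rw [add_mul, ← hm, ← hm', ← mul_add]
      rfl
    | mul x y hx hy ihx ihy =>
      obtain ⟨m, hm⟩ := ihx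
      obtain ⟨m', hm'⟩ := ihy
      refine ⟨m * m', ?_⟩
      rw [mul_assoc, ← hm', ← mul_assoc, ← hm, mul_assoc]
      rfl
  obtain ⟨m', hm'⟩ := key
  refine ⟨m', ?_⟩
  rw [h.normalElement_eq h2, smul_mul_assoc, mul_smul_comm, hm']

end Splits

end OSLq

/-! ### Combining `τ`, the normal element and the spinors. -/

namespace OSLq

section
variable {q : ℂ} [NeZero q] {α : Fin 3 → ℂ} {τ : sphere q α →ₐ[ℂ] Matrix (Fin 2) (Fin 2) ℂ}

/-- `e₋₁` and `e₁` go to nonzero multiples of the two off-diagonal matrix units, and their products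
in both orders give the diagonal ones. -/
theorem tau_surjective (h2 : q ^ 2 - 1 ≠ 0) (h4 : q ^ 4 + 1 ≠ 0) (h1 : α 1 ≠ 0)
    (hτ : ∀ i, τ ⟨sphereGen q α i, sphereGen_mem q α i⟩ = tauGen q α i) :
    Function.Surjective τ := by
  have hq : q ≠ 0 := NeZero.ne q
  set κ := (q ^ 2 - 1) / (q ^ 4 + 1) * α 1 with hκ
  have hκ0 : κ ≠ 0 := mul_ne_zero (div_ne_zero h2 h4) h1
  set e : Fin 3 → sphere q α := fun i => ⟨sphereGen q α i, sphereGen_mem q α i⟩ with he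
  intro M
  refine ⟨(M 0 1 / κ) • e 0 + (M 1 0 / (κ * q ^ 2)) • e 2 +
    (M 0 0 / (κ ^ 2 * q ^ 2)) • (e 0 * e 2) + (M 1 1 / (κ ^ 2 * q ^ 2)) • (e 2 * e 0), ?_⟩
  have h0 : τ (e 0) = κ • !![0, 1; 0, 0] := hτ 0
  have h2' : τ (e 2) = κ • !![0, 0; q ^ 2, 0] := hτ 2
  simp only [map_add, map_smul, map_mul, h0, h2']
  ext i j
  fin_cases i <;> fin_cases j <;> simp <;> field_simp

theorem exists_tau_normalElement_mul (h2 : q ^ 2 - 1 ≠ 0) (h2' : q ^ 2 + 1 ≠ 0)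
    (h4 : q ^ 4 + 1 ≠ 0) (h1 : α 1 ≠ 0)
    (hτ : ∀ i, τ ⟨sphereGen q α i, sphereGen_mem q α i⟩ = tauGen q α i) :
    ∃ g, τ (Splits.normalElement q α) * τ g = 1 := by
  have hq : q ≠ 0 := NeZero.ne q
  set z0 := -(q ^ 2 * (q ^ 2 + 1)) / (q ^ 4 + 1) * α 1 with hz0
  set z1 := -(q ^ 2 + 1) / (q ^ 4 + 1) * α 1 with hz1
  have h0 : z0 ≠ 0 :=
    mul_ne_zero (div_ne_zero (neg_ne_zero.2 (mul_ne_zero (pow_ne_zero 2 hq) h2')) h4) h1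
  have h0' : z1 ≠ 0 := mul_ne_zero (div_ne_zero (neg_ne_zero.2 h2') h4) h1
  have hZ : τ (Splits.normalElement q α) = !![z0, 0; 0, z1] := by
    rw [Splits.normalElement, map_sub, hτ, AlgHom.commutes]
    ext i j
    fin_cases i <;> fin_cases j <;>
      simp [tauGen, Matrix.algebraMap_matrix_apply, hz0, hz1] <;> field_simp <;> ring
  obtain ⟨g, hg⟩ := tau_surjective h2 h4 h1 hτ !![z0⁻¹, 0; 0, z1⁻¹]
  refine ⟨g, ?_⟩
  rw [hZ, hg]
  ext i j
  fin_cases i <;> fin_cases j <;> simp [h0, h0']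

/-- A splitting `r η ξ` of `α` together with the genericity conditions on `η` under which the inner
derivation of the spinor `ξ` has right dimension `2`. -/
structure Complement (q : ℂ) (α : Fin 3 → ℂ) (η ξ : Fin 2 → ℂ) (r : ℂ) : Prop
    extends Splits q α η ξ r where
  ne_one : η 0 * ξ 1 ≠ q * (η 1 * ξ 0)
  ne_two : η 1 * ξ 0 ≠ q ^ 3 * (η 0 * ξ 1)
  ne_three : η 1 * ξ 0 ≠ q * (η 0 * ξ 1)
  ne_four : η 1 * ξ 0 ≠ 0

variable {η ξ : Fin 2 → ℂ} {r : ℂ}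

/-- `ne_one` and `ne_two` pin down the values of a classical point, `ne_three` makes the constant
`k` of the exchange relation nonzero, and `ne_four` makes `φ` nonzero on `y₀ x₀`. -/
theorem Complement.rightDim_eq (h : Complement q α η ξ r) (h2 : q ^ 2 - 1 ≠ 0)
    (h2' : q ^ 2 + 1 ≠ 0) (h4 : q ^ 4 + 1 ≠ 0) (h1 : α 1 ≠ 0)
    (hτ : ∀ i, τ ⟨sphereGen q α i, sphereGen_mem q α i⟩ = tauGen q α i)
    (φ : sphere q α →ₐ[ℂ] ℂ) : (Covariant.innerDerivation τ (spinor q ξ)).rightDim φ = 2 := by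
  have hq : q ≠ 0 := NeZero.ne q
  set k := ξ 0 * η 1 - q * ξ 1 * η 0 with hk
  have hk0 : k ≠ 0 := fun e => h.ne_three (by linear_combination e)
  obtain ⟨h10, h01, hdet⟩ := h.classical_point h2' h2 h.ne_one h.ne_two φ
  obtain ⟨g, hg⟩ := exists_tau_normalElement_mul h2 h2' h4 h1 hτ
  -- The exchange relation `ξ₀ η₁ - q ξ₁ η₀ = k` between spinors, divided by `k`, says that these
  -- two multiples of the complementary spinor `η` are dual to `x`.
  have hyx : ∀ i j, (![k⁻¹ • spinor q η 1, (-q * k⁻¹) • spinor q η 0] : Fin 2 → OSLq q) i *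
      spinor q ξ j ∈ sphere q α := by
    intro i j
    fin_cases i
    · exact smul_mul_assoc k⁻¹ (spinor q η 1) (spinor q ξ j) ▸
        Subalgebra.smul_mem _ (h.spinor_mul_mem h2' 1 j) _
    · exact smul_mul_assoc (-q * k⁻¹) (spinor q η 0) (spinor q ξ j) ▸
        Subalgebra.smul_mem _ (h.spinor_mul_mem h2' 0 j) _
  have h0 : ∀ j, φ ⟨_, hyx 0 j⟩ = k⁻¹ * φ (h.prod h2' 1 j) := fun j =>
    (congrArg φ (Subtype.ext (smul_mul_assoc k⁻¹ (spinor q η 1) (spinor q ξ j)) :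
      (⟨_, hyx 0 j⟩ : sphere q α) = k⁻¹ • h.prod h2' 1 j)).trans (map_smul φ _ _)
  have h1' : ∀ j, φ ⟨_, hyx 1 j⟩ = (-q * k⁻¹) * φ (h.prod h2' 0 j) := fun j =>
    (congrArg φ (Subtype.ext (smul_mul_assoc (-q * k⁻¹) (spinor q η 0) (spinor q ξ j)) :
      (⟨_, hyx 1 j⟩ : sphere q α) = (-q * k⁻¹) • h.prod h2' 0 j)).trans (map_smul φ _ _)
  refine Covariant.rightDim_innerDerivation τ _ (tau_surjective h2 h4 h1 hτ) _ hyx ?_ φ ?_ ?_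
    (h.apply_normalElement h2' h2 h.ne_one h.ne_two φ) (h.exists_normalElement_mul h2') hg
  · have := spinor_mul_spinor q ξ η
    simp only [Matrix.cons_val_zero, Matrix.cons_val_one, mul_smul_comm, this, ← hk,
      Algebra.algebraMap_eq_smul_one, smul_add, smul_smul]
    rw [inv_mul_cancel₀ hk0]
    module
  · rw [h0, h10]
    exact mul_ne_zero (inv_ne_zero hk0) h.ne_four
  · rw [h0, h0, h1', h1']
    linear_combination q * k⁻¹ ^ 2 * hdet

theorem Complement.exists_tau_eq_one (h : Complement q α η ξ r) (h2 : q ^ 2 - 1 ≠ 0)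
    (h2' : q ^ 2 + 1 ≠ 0) (h4 : q ^ 4 + 1 ≠ 0) (h1 : α 1 ≠ 0)
    (hτ : ∀ i, τ ⟨sphereGen q α i, sphereGen_mem q α i⟩ = tauGen q α i) :
    ∃ b, τ b = 1 ∧ ∀ φ : sphere q α →ₐ[ℂ] ℂ, φ b = 0 := by
  obtain ⟨g, hg⟩ := exists_tau_normalElement_mul h2 h2' h4 h1 hτ
  refine ⟨Splits.normalElement q α * g, by rw [map_mul, hg], fun φ => ?_⟩
  rw [map_mul, h.apply_normalElement h2' h2 h.ne_one h.ne_two φ, zero_mul]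

theorem Complement.not_arisesFrom (h : Complement q α η ξ r) (h2 : q ^ 2 - 1 ≠ 0)
    (h2' : q ^ 2 + 1 ≠ 0) (h4 : q ^ 4 + 1 ≠ 0) (h1 : α 1 ≠ 0)
    (hτ : ∀ i, τ ⟨sphereGen q α i, sphereGen_mem q α i⟩ = tauGen q α i)
    (hL : Covariant.IsLeftCoideal
      (Covariant.opComul (Coalgebra.comul (R := ℂ) (A := OSLq q))) (sphere q α))
    (R : Submodule ℂ (Covariant.augKer (Bialgebra.counitAlgHom ℂ (OSLq q)) (sphere q α))) :
    ¬ Covariant.ArisesFrom hL (Covariant.innerDerivation τ (spinor q ξ)) R := by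
  intro hA
  obtain ⟨b, hb, hφ⟩ := h.exists_tau_eq_one h2 h2' h4 h1 hτ
  set φ := (Bialgebra.counitAlgHom ℂ (OSLq q)).comp (sphere q α).val with hφ'
  have hG := hA.Gam_eq_bot Covariant.lid_rTensor_opComul (b := b) (hφ φ)
    (Covariant.smul_eq_self_of_tau_eq_one τ _ hb)
  have hd := h.rightDim_eq h2 h2' h4 h1 hτ φ
  have hs : Subsingleton (Covariant.innerDerivation τ (spinor q ξ)).Gam := by
    rw [hG]
    infer_instance
  rw [Covariant.BimoduleDerivation.rightDim, rank_subsingleton'] at hd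
  exact two_ne_zero hd.symm

end

section
variable {q : ℂ} [NeZero q] {α : Fin 3 → ℂ} {y : ℂ}

/-- Cases (i) and (ii) say that `ξ` is proportional to `(1, q⁴ y)` or to `(1, y)`, the two possible
right factors of `α`; the left factors are then `(1, q y)` and `(1, q⁵ y)`. -/
theorem exists_complement (hq : ∀ n : ℕ, 1 ≤ n → q ^ n ≠ 1) (h4 : q ^ 4 + 1 ≠ 0) (h1 : α 1 ≠ 0)
    (hc : α 0 * α 2 / α 1 ^ 2 = specialParam q 2) (h2 : α 2 ≠ 0) (hy0 : y ≠ 0)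
    (hy : α 1 = α 2 * (y * (q ^ 4 + 1))) {ξ : Fin 2 → ℂ} (hξ : ξ 1 ≠ 0)
    (h : ξ 0 / ξ 1 = (q ^ 4 + 1) * α 2 / (q ^ 4 * α 1) ∨
      ξ 0 / ξ 1 = (q ^ 4 + 1) * α 2 / α 1) : ∃ η r, Complement q α η ξ r := by
  have q0 : q ≠ 0 := NeZero.ne q
  have hn : ∀ n, 1 ≤ n → 1 - q ^ n ≠ 0 := fun n h e => hq n h (by linear_combination -e)
  -- Each inequality required of a complement compares powers of q times a common factor, so the
  -- difference is a nonzero multiple of `1 - qⁿ` with n among 2, 4, 6.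
  have hne : ∀ (n : ℕ) (a b c : ℂ), 1 ≤ n → c ≠ 0 → a - b = c * (1 - q ^ n) → a ≠ b := by
    intro n a b c h hc e hab
    rw [hab, sub_self] at e
    exact mul_ne_zero hc (hn n h) e.symm
  rcases h with h | h
  · have h' : ξ 1 = q ^ 4 * y * ξ 0 := by
      rw [hy] at h
      field_simp at h
      linear_combination -h
    have h0 : ξ 0 ≠ 0 := by
      intro e
      rw [e, mul_zero] at h'
      exact hξ h'
    refine ⟨![1, q * y], α 2 / ξ 0, splits_special h4 h1 hc hy ?_ ?_ ?_, ?_, ?_, ?_, ?_⟩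
    · simp; field_simp
    · simp [h']; field_simp
    · simp [h']; ring
    · exact hne 2 _ _ (-q ^ 2 * y * ξ 0) (by norm_num) (by simp [q0, hy0, h0]) (by simp [h']; ring)
    · exact hne 6 _ _ (q * y * ξ 0) (by norm_num) (by simp [q0, hy0, h0]) (by simp [h']; ring)
    · exact hne 4 _ _ (q * y * ξ 0) (by norm_num) (by simp [q0, hy0, h0]) (by simp [h']; ring)
    · simp [q0, hy0, h0]
  · have h' : ξ 1 = y * ξ 0 := by
      rw [hy] at h
      field_simp at h
      linear_combination -h
    have h0 : ξ 0 ≠ 0 := by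
      intro e
      rw [e, mul_zero] at h'
      exact hξ h'
    refine ⟨![1, q ^ 5 * y], α 2 / ξ 0, splits_special h4 h1 hc hy ?_ ?_ ?_, ?_, ?_, ?_, ?_⟩
    · simp; field_simp
    · simp [h']; field_simp; ring
    · simp [h']; ring
    · exact hne 6 _ _ (y * ξ 0) (by norm_num) (by simp [hy0, h0]) (by simp [h']; ring)
    · exact hne 2 _ _ (-q ^ 3 * y * ξ 0) (by norm_num) (by simp [q0, hy0, h0]) (by simp [h']; ring)
    · exact hne 4 _ _ (-q * y * ξ 0) (by norm_num) (by simp [q0, hy0, h0]) (by simp [h']; ring)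
    · simp [q0, hy0, h0]

end

end OSLq

/-! ### Conclusion. -/

theorem mainTheorem4 (q : ℂ) [NeZero q] (hq : ∀ n : ℕ, 1 ≤ n → q ^ n ≠ 1) :
    (∀ α : Fin 3 → ℂ, α 1 ≠ 0 → α 0 * α 2 / α 1 ^ 2 = OSLq.specialParam q 2 →
      ∃ (hR : Covariant.IsRightCoideal
            (Coalgebra.comul (R := ℂ) (A := OSLq q)) (OSLq.sphere q α))
        (hL : Covariant.IsLeftCoideal
            (Covariant.opComul (Coalgebra.comul (R := ℂ) (A := OSLq q))) (OSLq.sphere q α))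
        (τ : OSLq.sphere q α →ₐ[ℂ] Matrix (Fin 2) (Fin 2) ℂ),
        (∀ i, τ ⟨OSLq.sphereGen q α i, OSLq.sphereGen_mem q α i⟩ = OSLq.tauGen q α i) ∧
        (∀ ξ : Fin 2 → ℂ, ξ 1 ≠ 0 →
          (ξ 0 / ξ 1 = (q ^ 4 + 1) * α 2 / (q ^ 4 * α 1) ∨
            ξ 0 / ξ 1 = (q ^ 4 + 1) * α 2 / α 1) →
          (Covariant.innerDerivation τ (OSLq.spinor q ξ)).IsRightEquivariant hR ∧
          (∀ φ : OSLq.sphere q α →ₐ[ℂ] ℂ,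
            (Covariant.innerDerivation τ (OSLq.spinor q ξ)).rightDim φ = 2 ∧
            (Covariant.innerDerivation τ (OSLq.spinor q ξ)).leftDim φ = 0) ∧
          (Covariant.innerDerivation τ (OSLq.spinor q ξ)).IsLeftEquivariant hL ∧
          ¬ ∃ R : Submodule ℂ
              (Covariant.augKer (Bialgebra.counitAlgHom ℂ (OSLq q)) (OSLq.sphere q α)),
            Covariant.IsRightIdeal R ∧
            Covariant.ArisesFrom hL (Covariant.innerDerivation τ (OSLq.spinor q ξ)) R) ∧
        ¬ Covariant.OneToOneCorrespondence hL (Bialgebra.counitAlgHom ℂ (OSLq q))) ∧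
    ¬ ∀ (A : Type) [Ring A] [HopfAlgebra ℂ A] (B : Subalgebra ℂ A)
        (hB : Covariant.IsLeftCoideal (Coalgebra.comul (R := ℂ) (A := A)) B),
        Covariant.OneToOneCorrespondence hB (Bialgebra.counitAlgHom ℂ A) := by
  have q0 : q ≠ 0 := NeZero.ne q
  have h2 : q ^ 2 - 1 ≠ 0 := fun e => hq 2 (by norm_num) (by linear_combination e)
  have h2' : q ^ 2 + 1 ≠ 0 := fun e =>
    hq 4 (by norm_num) (by linear_combination (q ^ 2 - 1) * e)
  have h4 : q ^ 4 + 1 ≠ 0 := fun e =>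
    hq 8 (by norm_num) (by linear_combination (q ^ 4 - 1) * e)
  have hparam : OSLq.specialParam q 2 = -q ^ 4 / (q ^ 4 + 1) ^ 2 := by
    norm_num [OSLq.specialParam]
  refine (fun H => ⟨H, fun hall => ?_⟩) ?_
  · intro α h1 hc
    have hα2 : α 2 ≠ 0 := by
      intro e
      rw [hparam, e, mul_zero, zero_div, eq_comm, div_eq_zero_iff] at hc
      rcases hc with hc | hc
      · exact pow_ne_zero 4 q0 (neg_eq_zero.1 hc)
      · exact pow_ne_zero 2 h4 hc
    obtain ⟨y, hy⟩ : ∃ y, α 1 = α 2 * (y * (q ^ 4 + 1)) :=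
      ⟨α 1 / (α 2 * (q ^ 4 + 1)), by field_simp⟩
    have hy0 : y ≠ 0 := by
      rintro rfl
      simp [hy] at h1
    -- This one splitting yields the coideal property, `τ` and equivariance in both cases; only the
    -- dimension count uses the splitting adapted to `ξ`.
    have hS : OSLq.Splits q α ![1, q ^ 5 * y] ![1, y] (α 2) :=
      OSLq.splits_special h4 h1 hc hy (by simp) (by simp; field_simp; ring) (by simp; ring)
    have hR := hS.isRightCoideal h2'
    have hL := hR.op
    obtain ⟨τ, hτ⟩ := OSLq.exists_tau h2 h4 h1 hy hS
    have hprod := OSLq.tau_prod h2' h4 hy hS hτ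
    have hequi := fun ξ => OSLq.innerDerivation_spinor_isRightEquivariant h2' hS hprod hR ξ
    have hcompl := fun (ξ : Fin 2 → ℂ) (hξ : ξ 1 ≠ 0) h =>
      OSLq.exists_complement hq h4 h1 hc hα2 hy0 hy hξ h
    refine ⟨hR, hL, τ, hτ, fun ξ hξ h => ⟨hequi ξ, fun φ => ?_, (hequi ξ).op hL, ?_⟩, fun H => ?_⟩
    · obtain ⟨η, r, hC⟩ := hcompl ξ hξ h
      obtain ⟨b, hb, hφ⟩ := hC.exists_tau_eq_one h2 h2' h4 h1 hτ
      exact ⟨hC.rightDim_eq h2 h2' h4 h1 hτ φ,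
        Covariant.BimoduleDerivation.leftDim_eq_zero _ (hφ φ)
          (Covariant.smul_eq_self_of_tau_eq_one τ _ hb)⟩
    · obtain ⟨η, r, hC⟩ := hcompl ξ hξ h
      rintro ⟨R, _, hA⟩
      exact hC.not_arisesFrom h2 h2' h4 h1 hτ hL R hA
    -- A spinor of case (ii) refutes the half of the correspondence that recovers an equivariant `δ`
    -- from `R_δ`.
    · obtain ⟨η, r, hC⟩ := hcompl ![(q ^ 4 + 1) * α 2 / α 1, 1] (by simp) (Or.inr (by simp))
      exact hC.not_arisesFrom h2 h2' h4 h1 hτ hL _ (H.2 _ ((hequi _).op hL)).2.2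
  -- A concrete triple with parameter `c(2)`; it corresponds to `y = 1` and `α₁ = 1`.
  · obtain ⟨_, hL, _, _, _, hn⟩ := H ![-q ^ 4, q ^ 4 + 1, 1] (by simpa using h4)
      (by rw [hparam]; simp)
    exact hn ((@hall (OSLq q) _ (OSLq.copHopfAlgebra q) _ hL).congr
      (OSLq.copHopfAlgebra_comul q))
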